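/- Let $X$ be a complex Banach space and let $A:D(A)\subset X\to X$ be the generator of a $C_0$-semigroup $(S(t))_{t\ge 0}$ on $X$ with exponential growth bound $\omega_0<0$; that is, for every $w>\omega_0$ there is a constant $C$ with $\|S(t)\|\le Ce^{wt}$ for all $t\ge 0$ (this holds in particular if $\|S(t)\|\le Ce^{\omega_0 t}$ for all $t\ge 0$). For $\beta\in(0,1]$ let $$F_\beta=\{y\in X:\ \|y\|_{F_\beta}<\infty\},\qquad \|y\|_{F_\beta}=\sup_{t>0}\frac{1}{t^{\beta}}\|S(t)y-y\|_X,$$ be the Favard space of order $\beta$. Let $\alpha\in(0,1]$, $x\in F_\alpha$ and $\omega>\omega_0$. Then every $\lambda\in\mathbb C$ with $\operatorname{Re}\lambda>\omega_0$ belongs to the resolvent set of $A$, the map $\lambda\mapsto(\lambda-A)^{-1}x$ is continuous on $\{\operatorname{Re}\lambda>\omega_0\}$, and $$S(t)x-e^{\omega_0 t}x=\lim_{R\to\infty}\frac{1}{2\pi i}\int_{\omega-iR}^{\omega+iR}e^{\lambda t}\Big((\lambda-A)^{-1}-\frac{1}{\lambda-\omega_0}\Big)x\,d\lambda\quad\text{locally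 uniformly in } t\in[0,\infty),$$ $$S(t)x=\lim_{R\to\infty}\frac{1}{2\pi i}\int_{\omega-iR}^{\omega+iR}e^{\lambda t}(\lambda-A)^{-1}x\,d\lambda\quad\text{locally uniformly in } t\in(0,\infty).$$ Both limits hold with respect to the norm of $X$ and, for every $\alpha'\in(0,\alpha)$, with respect to the norm of $F_{\alpha'}$ (in particular, the left-hand sides, and the integrals for all $R>0$, are elements of $F_{\alpha'}$ for the respective $t$). -/

import Mathlib

open Filter Topology
open scoped ENNReal

/-- A `C₀`-semigroup (strongly continuous one-parameter semigroup of bounded linear operators) on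
the complex normed space `X`. Only the values at times `t ≥ 0` matter. -/
structure C0Semigroup (X : Type*) [NormedAddCommGroup X] [NormedSpace ℂ X] where
  /-- the operator `S(t)` -/
  op : ℝ → X →L[ℂ] X
  op_zero : op 0 = ContinuousLinearMap.id ℂ X
  op_add : ∀ s t : ℝ, 0 ≤ s → 0 ≤ t → op (s + t) = (op s).comp (op t)
  continuousOn_orbit : ∀ x : X, ContinuousOn (fun t : ℝ => op t x) (Set.Ici 0)

namespace C0Semigroup

variable {X : Type*} [NormedAddCommGroup X] [NormedSpace ℂ X]

/-- `y` is the right derivative at `0` of the orbit of `x`, i.e. `(S(h)x - x)/h → y` as `h ↓ 0`. -/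
def HasGeneratorValue (S : C0Semigroup X) (x y : X) : Prop :=
  Tendsto (fun h : ℝ => (h : ℂ)⁻¹ • (S.op h x - x)) (𝓝[>] 0) (𝓝 y)

theorem HasGeneratorValue.add {S : C0Semigroup X} {x₁ x₂ y₁ y₂ : X}
    (h₁ : S.HasGeneratorValue x₁ y₁) (h₂ : S.HasGeneratorValue x₂ y₂) :
    S.HasGeneratorValue (x₁ + x₂) (y₁ + y₂) := by
  refine (Tendsto.add h₁ h₂).congr fun h => ?_
  rw [← smul_add, map_add]
  congr 1
  abel

theorem HasGeneratorValue.smul {S : C0Semigroup X} {x y : X} (c : ℂ)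
    (h₁ : S.HasGeneratorValue x y) : S.HasGeneratorValue (c • x) (c • y) := by
  refine (Tendsto.const_smul h₁ c).congr fun h => ?_
  rw [map_smul, ← smul_sub, smul_comm]

theorem HasGeneratorValue.zero (S : C0Semigroup X) : S.HasGeneratorValue 0 0 := by
  simp [HasGeneratorValue]

theorem HasGeneratorValue.unique {S : C0Semigroup X} {x y₁ y₂ : X}
    (h₁ : S.HasGeneratorValue x y₁) (h₂ : S.HasGeneratorValue x y₂) : y₁ = y₂ :=
  tendsto_nhds_unique h₁ h₂

/-- The (infinitesimal) generator of `S`: the unbounded operator `A x = lim_{h ↓ 0} (S(h)x - x)/h`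
whose domain `D(A)` consists of all `x` for which this limit exists. -/
noncomputable def generator (S : C0Semigroup X) : X →ₗ.[ℂ] X where
  domain :=
    { carrier := {x | ∃ y, S.HasGeneratorValue x y}
      add_mem' := fun ⟨_, h₁⟩ ⟨_, h₂⟩ => ⟨_, h₁.add h₂⟩
      zero_mem' := ⟨0, HasGeneratorValue.zero S⟩
      smul_mem' := fun c _ ⟨_, h₁⟩ => ⟨_, h₁.smul c⟩ }
  toFun :=
    { toFun := fun x => x.2.choose
      map_add' := fun x₁ x₂ =>
        (x₁ + x₂).2.choose_spec.unique (x₁.2.choose_spec.add x₂.2.choose_spec)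
      map_smul' := fun c x => (c • x).2.choose_spec.unique (x.2.choose_spec.smul c) }

/-- `S` has exponential growth bound (at most) `ω₀`: for every `w > ω₀` there is a constant `C`
such that `‖S(t)‖ ≤ C e^{wt}` for all `t ≥ 0`. This holds in particular if
`‖S(t)‖ ≤ C e^{ω₀ t}` for all `t ≥ 0`, and also if `ω₀` is the infimum of all `w` admitting
such a constant. -/
def HasGrowthBound (S : C0Semigroup X) (ω₀ : ℝ) : Prop :=
  ∀ w : ℝ, ω₀ < w → ∃ C : ℝ, ∀ t : ℝ, 0 ≤ t → ‖S.op t‖ ≤ C * Real.exp (w * t)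

/-- The Favard norm `‖x‖_{F_α} = sup_{t > 0} t^{-α} ‖S(t)x - x‖`, with values in `[0, ∞]`. -/
noncomputable def favardNorm (S : C0Semigroup X) (α : ℝ) (x : X) : ℝ≥0∞ :=
  ⨆ t : Set.Ioi (0 : ℝ), ENNReal.ofReal (‖S.op (t : ℝ) x - x‖ / (t : ℝ) ^ α)

/-- The Favard space `F_α = {x ∈ X : ‖x‖_{F_α} < ∞}`. -/
def favardSpace (S : C0Semigroup X) (α : ℝ) : Set X :=
  {x | S.favardNorm α x < ∞}

/-- The functions `G R : s → F_α` converge to `F : s → F_α` as `R → ∞`, locally uniformly on `s`,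
with respect to the norm of `F_α`: the analogue of `TendstoLocallyUniformlyOn G F atTop s`. -/
def FavardTendstoLocallyUniformlyOn (S : C0Semigroup X) (α : ℝ) (G : ℝ → ℝ → X) (F : ℝ → X)
    (s : Set ℝ) : Prop :=
  (∀ t ∈ s, F t ∈ S.favardSpace α) ∧
  (∀ R > 0, ∀ t ∈ s, G R t ∈ S.favardSpace α) ∧
  ∀ ε : ℝ≥0∞, 0 < ε → ∀ t ∈ s, ∃ V ∈ 𝓝[s] t, ∀ᶠ R in atTop, ∀ τ ∈ V,
    S.favardNorm α (F τ - G R τ) < ε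

end C0Semigroup

section Resolvent

variable {X : Type*} [NormedAddCommGroup X] [NormedSpace ℂ X]

/-- `B` is a bounded two-sided inverse of `z - A : D(A) → X`. -/
def IsResolventAt (A : X →ₗ.[ℂ] X) (z : ℂ) (B : X →L[ℂ] X) : Prop :=
  (∀ x : X, ∃ h : B x ∈ A.domain, z • B x - A ⟨B x, h⟩ = x) ∧
  ∀ x : A.domain, B (z • (x : X) - A x) = x

/-- The resolvent set `ρ(A)` of an unbounded operator `A`. -/
def unboundedResolventSet (A : X →ₗ.[ℂ] X) : Set ℂ :=
  {z | ∃ B : X →L[ℂ] X, IsResolventAt A z B}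

open scoped Classical in
/-- The resolvent `(z - A)⁻¹` for `z ∈ ρ(A)`, with the value `0` for `z ∉ ρ(A)`. -/
noncomputable def unboundedResolvent (A : X →ₗ.[ℂ] X) (z : ℂ) : X →L[ℂ] X :=
  if h : z ∈ unboundedResolventSet A then h.choose else 0

/-- The truncated complex inversion integral
`(1 / 2πi) ∫_{ω - iR}^{ω + iR} e^{zt} G(z) dz` along the segment `z = ω + ik`, `-R ≤ k ≤ R`,
so that `dz = i dk`. -/
noncomputable def inversionIntegral (G : ℂ → X) (ω R t : ℝ) : X :=
  (2 * (Real.pi : ℂ) * Complex.I)⁻¹ •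
    ∫ k in (-R)..R, (Complex.exp (((ω : ℂ) + k * Complex.I) * t) * Complex.I) •
      G ((ω : ℂ) + k * Complex.I)

end Resolvent

/-! On the line `Re z = ω` the resolvent applied to `x` is the Fourier transform of `s ↦ e^{-ωs}
S(s)x` on `s > 0`, so both formulas are Fourier inversion with symmetric truncation. The orbit
extended by zero jumps at `0`. Subtracting `e^{ω₀ s} x`, whose transform is `(z - ω₀)⁻¹ x`, removes
the jump, and for `x ∈ F_α` the result (`correctedOrbit`) is Hölder of order `α` on the whole line,
both in the supremum norm and in `L¹`.

Such functions are inverted with an explicit rate (`HolderMean.norm_partialInversion_sub_le`).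
Averaging twice over a length `ε` makes the transform `O(ε⁻² k⁻²)`, so absolutely convergent
inversion has error `O(1 / (ε² R))`. The averaging changes the function by `O(ε^β)`, and partial
inversion amplifies this by at most a multiple of `R^δ` (`norm_partialInversion_le`). With `ε =
R^{-1/4}` and `δ = β/8` the total is `O(R^{-β/8})`.

The rate is linear in a number `N` bounding both `‖y‖` and the Hölder constant of the orbit of `y`.
This gives the Favard norms at no extra cost: the truncated integrals commute with `S(h)`, and `y =
S(h)x - x` satisfies the hypotheses with Hölder order `α - α'` and constant `N h^{α'}`
(`exists_increment_bound`). Dividing the resulting estimate by `h^{α'}` bounds the `F_{α'}` norm of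
the error.

For the second formula the scalar part is restored: by an integration by parts the truncated
inversion of `(z - ω₀)⁻¹` has error `O(1 / (tR))`, which is locally uniform only on `t > 0`. -/

/-! ### Fourier inversion for vector-valued functions with quadratically decaying transform. -/

section FourierInversion

open MeasureTheory Set

variable {E : Type*} [NormedAddCommGroup E] [NormedSpace ℂ E]

/-- The Fourier transform in the angular frequency `k`. -/
noncomputable def angularFourier (g : ℝ → E) (k : ℝ) : E :=
  ∫ s : ℝ, Complex.exp (-((k * s : ℝ) : ℂ) * Complex.I) • g s

/-- The symmetric partial Fourier inversion integral over the frequencies `-R ≤ k ≤ R`. -/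
noncomputable def partialInversion (g : ℝ → E) (R t : ℝ) : E :=
  (2 * Real.pi : ℂ)⁻¹ •
    ∫ k in (-R)..R, Complex.exp (((k * t : ℝ) : ℂ) * Complex.I) • angularFourier g k

theorem norm_exp_neg_mul_I (x : ℝ) : ‖Complex.exp (-(x : ℂ) * Complex.I)‖ = 1 := by
  have := Complex.norm_exp_ofReal_mul_I (-x)
  simpa using this

theorem integrable_exp_smul {g : ℝ → E} (hg : Integrable g) (k : ℝ) :
    Integrable fun s : ℝ => Complex.exp (-((k * s : ℝ) : ℂ) * Complex.I) • g s := by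
  have hc : Continuous fun s : ℝ => Complex.exp (-((k * s : ℝ) : ℂ) * Complex.I) := by fun_prop
  exact hg.bdd_smul 1 hc.aestronglyMeasurable
    (Eventually.of_forall fun s => (norm_exp_neg_mul_I _).le)

theorem continuous_angularFourier {g : ℝ → E} (hg : Integrable g) :
    Continuous (angularFourier g) := by
  refine continuous_of_dominated (bound := fun s => ‖g s‖)
    (fun k => (integrable_exp_smul hg k).aestronglyMeasurable) (fun k => ?_) hg.norm ?_
  · exact Eventually.of_forall fun s => by rw [norm_smul, norm_exp_neg_mul_I, one_mul]
  · exact Eventually.of_forall fun s => by fun_prop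

theorem norm_angularFourier_le (g : ℝ → E) (k : ℝ) :
    ‖angularFourier g k‖ ≤ ∫ s, ‖g s‖ := by
  refine (norm_integral_le_integral_norm _).trans_eq ?_
  simp only [norm_smul, norm_exp_neg_mul_I, one_mul]

theorem angularFourier_inversion [CompleteSpace E] {g : ℝ → E} (hc : Continuous g)
    (hg : Integrable g) (hg' : Integrable (angularFourier g)) (t : ℝ) :
    (2 * Real.pi : ℂ)⁻¹ •
      ∫ k, Complex.exp (((k * t : ℝ) : ℂ) * Complex.I) • angularFourier g k = g t := by
  -- Mathlib's transform uses the frequency `ξ` with `k = 2πξ`; this change of variable produces the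
  -- factor `(2π)⁻¹`.
  have hF : FourierTransform.fourier g = fun ξ : ℝ => angularFourier g (2 * Real.pi * ξ) := by
    ext ξ
    rw [Real.fourier_real_eq_integral_exp_smul]
    refine integral_congr_ae (Eventually.of_forall fun s => ?_)
    simp only
    congr 3
    push_cast
    ring
  have hpi : (2 * Real.pi) ≠ 0 := by positivity
  have h1 := MeasureTheory.Integrable.fourierInv_fourier_eq hg
    (by rw [hF]; exact hg'.comp_mul_left' hpi) (hc.continuousAt (x := t))
  rw [Real.fourierInv_eq', hF] at h1
  rw [← h1]
  have := Measure.integral_comp_mul_left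
    (fun k : ℝ => Complex.exp (((k * t : ℝ) : ℂ) * Complex.I) • angularFourier g k) (2 * Real.pi)
  have e : ∀ v : ℝ, Complex.exp (((2 * Real.pi * inner ℝ v t : ℝ) : ℂ) * Complex.I) •
      angularFourier g (2 * Real.pi * v) = Complex.exp (((2 * Real.pi * v * t : ℝ) : ℂ) * Complex.I)
        • angularFourier g (2 * Real.pi * v) := by
    intro v
    congr 4
    simp
    ring
  simp only [e]
  rw [this, abs_of_pos (by positivity), ← Complex.coe_smul]
  congr 1
  push_cast
  rfl

/-- A continuous function which is `O(k⁻²)` is integrable, with tails `O(R⁻¹)`. -/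
theorem integrable_and_tail_le {F : ℝ → E} (hF : Continuous F) {C : ℝ}
    (hC : ∀ k : ℝ, k ≠ 0 → ‖F k‖ ≤ C / k ^ 2) :
    Integrable F ∧ ∀ R : ℝ, 0 < R → ‖(∫ k in (-R)..R, F k) - ∫ k, F k‖ ≤ 2 * C / R := by
  have hpow : ∀ k : ℝ, 0 < k → C / k ^ 2 = C * k ^ (-2 : ℝ) := by
    intro k hk
    rw [Real.rpow_neg hk.le, Real.rpow_two, div_eq_mul_inv]
  have key : ∀ G : ℝ → E, Continuous G → (∀ k : ℝ, k ≠ 0 → ‖G k‖ ≤ C / k ^ 2) → ∀ R : ℝ, 0 < R →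
      IntegrableOn G (Ioi R) ∧ ‖∫ k in Ioi R, G k‖ ≤ C / R := by
    intro G hG hGC R hR
    have hi : IntegrableOn (fun k : ℝ => C * k ^ (-2 : ℝ)) (Ioi R) :=
      (integrableOn_Ioi_rpow_of_lt (by norm_num) hR).const_mul C
    have hb : ∀ᵐ k ∂(volume.restrict (Ioi R)), ‖G k‖ ≤ C * k ^ (-2 : ℝ) := by
      refine (ae_restrict_iff' measurableSet_Ioi).2 (Eventually.of_forall fun k hk => ?_)
      have hk0 : 0 < k := hR.trans hk
      rw [← hpow k hk0]
      exact hGC k hk0.ne'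
    refine ⟨Integrable.mono' hi hG.aestronglyMeasurable hb, ?_⟩
    refine (norm_integral_le_of_norm_le hi hb).trans_eq ?_
    rw [integral_const_mul, integral_Ioi_rpow_of_lt (by norm_num) hR]
    norm_num
    rw [Real.rpow_neg_one]
    rfl
  have hneg : ∀ k : ℝ, k ≠ 0 → ‖F (-k)‖ ≤ C / k ^ 2 := by
    intro k hk
    have := hC (-k) (neg_ne_zero.2 hk)
    rwa [neg_sq] at this
  have kp := key F hF hC
  have kn := key (fun k => F (-k)) (hF.comp continuous_neg) hneg
  have hiic : ∀ R : ℝ, 0 < R → IntegrableOn F (Iic (-R)) := by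
    intro R hR
    have h : IntegrableOn (fun k => F (-k)) (Ioi (- -R)) := by
      rw [neg_neg]; exact (kn R hR).1
    have h2 := h.comp_neg_Iio
    simp only [neg_neg] at h2
    exact (integrableOn_Iic_iff_integrableOn_Iio enorm_ne_top).2 h2
  have hmid : ∀ R : ℝ, IntegrableOn F (Ioc (-R) R) := fun R =>
    (hF.integrableOn_Icc).mono_set Ioc_subset_Icc_self
  have hint : Integrable F := by
    rw [← integrableOn_univ]
    have : (univ : Set ℝ) = Iic (-1) ∪ Ioc (-1) 1 ∪ Ioi 1 := by
      rw [Iic_union_Ioc_eq_Iic (by norm_num), Iic_union_Ioi]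
    rw [this]
    exact ((hiic 1 one_pos).union (hmid 1)).union (kp 1 one_pos).1
  refine ⟨hint, fun R hR => ?_⟩
  have e1 : ∫ k, F k = (∫ k in Iic (-R), F k) + (∫ k in (-R)..R, F k) + ∫ k in Ioi R, F k := by
    rw [← intervalIntegral.integral_Iic_add_Ioi (b := R) hint.integrableOn hint.integrableOn,
      ← intervalIntegral.integral_Iic_sub_Iic (hint.integrableOn (s := Iic (-R)))
        (hint.integrableOn (s := Iic R))]
    abel
  have e2 : ∫ k in Iic (-R), F k = ∫ k in Ioi R, F (-k) := by
    rw [integral_comp_neg_Ioi]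
  rw [e1, e2]
  have := (kp R hR).2
  have := (kn R hR).2
  calc _ = ‖(∫ k in Ioi R, F (-k)) + ∫ k in Ioi R, F k‖ := by
        rw [← norm_neg]; congr 1; abel
    _ ≤ C / R + C / R := norm_add_le_of_le (kn R hR).2 (kp R hR).2
    _ = 2 * C / R := by ring

/-- The error is the part of an absolutely convergent inversion integral over `|k| > R`. Its bound
`2C/R` is multiplied by `(2π)⁻¹ ≤ 1/2`. -/
theorem norm_partialInversion_sub_le [CompleteSpace E] {g : ℝ → E} (hc : Continuous g)
    (hg : Integrable g) {C : ℝ} (hC : ∀ k : ℝ, k ≠ 0 → ‖angularFourier g k‖ ≤ C / k ^ 2)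
    {R : ℝ} (hR : 0 < R) (t : ℝ) : ‖partialInversion g R t - g t‖ ≤ C / R := by
  have hcont := continuous_angularFourier hg
  have hI := (integrable_and_tail_le hcont hC).1
  have hT := (integrable_and_tail_le
    (F := fun k : ℝ => Complex.exp (((k * t : ℝ) : ℂ) * Complex.I) • angularFourier g k)
    (by fun_prop) (C := C) fun k hk => by
      rw [norm_smul, Complex.norm_exp_ofReal_mul_I, one_mul]; exact hC k hk).2 R hR
  have hC0 : 0 ≤ C := by
    have := (norm_nonneg _).trans (hC 1 one_ne_zero)
    simpa using this
  rw [← angularFourier_inversion hc hg hI t, partialInversion, ← smul_sub, norm_smul]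
  have hn : ‖(2 * Real.pi : ℂ)⁻¹‖ ≤ 2⁻¹ := by
    rw [norm_inv, norm_mul, Complex.norm_real, Complex.norm_ofNat, Real.norm_of_nonneg Real.pi_nonneg]
    apply inv_anti₀ (by norm_num)
    nlinarith [Real.pi_gt_three]
  calc _ ≤ 2⁻¹ * (2 * C / R) := mul_le_mul hn hT (norm_nonneg _) (by norm_num)
    _ = C / R := by ring

end FourierInversion

/-! ### Inversion with a polynomial rate for Hölder functions: Steklov means and the Dirichlet
kernel. -/

section HolderInversion

open MeasureTheory Set

variable {E : Type*} [NormedAddCommGroup E] [NormedSpace ℂ E]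

/-- Hölder continuity of order `β` with constant `N`, in the supremum norm and in the mean. -/
structure HolderMean (g : ℝ → E) (β N : ℝ) : Prop where
  continuous : Continuous g
  lintegral_le : ∫⁻ s, ‖g s‖ₑ ≤ ENNReal.ofReal N
  norm_sub_le : ∀ h ∈ Icc (0 : ℝ) 1, ∀ s, ‖g (s + h) - g s‖ ≤ N * h ^ β
  lintegral_sub_le : ∀ h ∈ Icc (0 : ℝ) 1, ∫⁻ s, ‖g (s + h) - g s‖ₑ ≤ ENNReal.ofReal (N * h ^ β)

theorem integrable_of_lintegral_enorm_le {F : Type*} [NormedAddCommGroup F] {g : ℝ → F} (hc : Continuous g) {N : ℝ}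
    (h : ∫⁻ s, ‖g s‖ₑ ≤ ENNReal.ofReal N) : Integrable g :=
  ⟨hc.aestronglyMeasurable, h.trans_lt ENNReal.ofReal_lt_top⟩

theorem integral_norm_le_of_lintegral_enorm_le {F : Type*} [NormedAddCommGroup F] {g : ℝ → F} (hc : Continuous g) {N : ℝ}
    (hN : 0 ≤ N) (h : ∫⁻ s, ‖g s‖ₑ ≤ ENNReal.ofReal N) : ∫ s, ‖g s‖ ≤ N := by
  rw [integral_norm_eq_lintegral_enorm hc.aestronglyMeasurable]
  exact ENNReal.toReal_le_of_le_ofReal hN h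

theorem HolderMean.integrable {F : Type*} [NormedAddCommGroup F] {g : ℝ → F} {β N : ℝ} (hg : HolderMean g β N) : Integrable g :=
  integrable_of_lintegral_enorm_le hg.continuous hg.lintegral_le

theorem norm_unitIntegral_le {f : ℝ → E} {c : ℝ} (hf : ∀ a ∈ Icc (0 : ℝ) 1, ‖f a‖ ≤ c) :
    ‖∫ a in (0 : ℝ)..1, f a‖ ≤ c := by
  have := intervalIntegral.norm_integral_le_of_norm_le_const (a := 0) (b := 1) (f := f) (C := c)
    fun a ha => hf a (by rw [uIoc_of_le zero_le_one] at ha; exact Ioc_subset_Icc_self ha)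
  simpa using this

theorem lintegral_enorm_unitIntegral_le {F : ℝ → ℝ → E} (hF : Continuous (Function.uncurry F))
    {c : ℝ≥0∞} (h : ∀ a ∈ Icc (0 : ℝ) 1, ∫⁻ t, ‖F t a‖ₑ ≤ c) :
    ∫⁻ t, ‖∫ a in (0 : ℝ)..1, F t a‖ₑ ≤ c := by
  calc ∫⁻ t, ‖∫ a in (0 : ℝ)..1, F t a‖ₑ
      ≤ ∫⁻ t, ∫⁻ a in Ioc (0 : ℝ) 1, ‖F t a‖ₑ := by
        refine lintegral_mono fun t => ?_
        simp only [intervalIntegral.integral_of_le zero_le_one]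
        exact enorm_integral_le_lintegral_enorm _
    _ = ∫⁻ a in Ioc (0 : ℝ) 1, ∫⁻ t, ‖F t a‖ₑ :=
        lintegral_lintegral_swap hF.enorm.aemeasurable
    _ ≤ ∫⁻ _ in Ioc (0 : ℝ) 1, c :=
        setLIntegral_mono measurable_const fun a ha => h a (Ioc_subset_Icc_self ha)
    _ = c := by simp

/-- The mean of `g` over `[t, t + ε]`. -/
noncomputable def steklovMean (ε : ℝ) (g : ℝ → E) (t : ℝ) : E :=
  ∫ a in (0 : ℝ)..1, g (t + ε * a)

theorem steklovMean_sub {ε : ℝ} {g : ℝ → E} [CompleteSpace E] (hg : Continuous g) (t : ℝ) :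
    steklovMean ε g t - g t = ∫ a in (0 : ℝ)..1, (g (t + ε * a) - g t) := by
  rw [intervalIntegral.integral_sub (Continuous.intervalIntegrable (by fun_prop) _ _)
    (Continuous.intervalIntegrable (by fun_prop) _ _)]
  simp [steklovMean]

theorem continuous_steklovMean (ε : ℝ) {g : ℝ → E} (hg : Continuous g) :
    Continuous (steklovMean ε g) :=
  intervalIntegral.continuous_parametric_intervalIntegral_of_continuous'
    (f := fun t a => g (t + ε * a)) (by simp only [Function.uncurry_def]; fun_prop) _ _

theorem HolderMean.steklovMean {g : ℝ → E} {β N : ℝ} (hg : HolderMean g β N) (ε : ℝ) :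
    HolderMean (steklovMean ε g) β N := by
  have hc := hg.continuous
  have hsub : ∀ h s : ℝ, _root_.steklovMean ε g (s + h) - _root_.steklovMean ε g s =
      ∫ a in (0 : ℝ)..1, (g (s + ε * a + h) - g (s + ε * a)) := by
    intro h s
    rw [intervalIntegral.integral_sub (Continuous.intervalIntegrable (by fun_prop) _ _)
      (Continuous.intervalIntegrable (by fun_prop) _ _)]
    simp only [_root_.steklovMean, add_right_comm s h]
  refine ⟨continuous_steklovMean ε hc, ?_, fun h hh s => ?_, fun h hh => ?_⟩
  · refine lintegral_enorm_unitIntegral_le (F := fun t a => g (t + ε * a))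
      (by simp only [Function.uncurry_def]; fun_prop) fun a _ => ?_
    rw [lintegral_add_right_eq_self (fun t => ‖g t‖ₑ)]
    exact hg.lintegral_le
  · rw [hsub]
    exact norm_unitIntegral_le fun a _ => hg.norm_sub_le h hh _
  · simp only [hsub]
    refine lintegral_enorm_unitIntegral_le
      (F := fun s a => g (s + ε * a + h) - g (s + ε * a))
      (by simp only [Function.uncurry_def]; fun_prop) fun a _ => ?_
    rw [lintegral_add_right_eq_self (fun t => ‖g (t + h) - g t‖ₑ)]
    exact hg.lintegral_sub_le h hh

theorem HolderMean.steklovMean_sub_le [CompleteSpace E] {g : ℝ → E} {β N : ℝ}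
    (hg : HolderMean g β N) (hβ : 0 ≤ β) (hN : 0 ≤ N) {ε : ℝ} (hε : ε ∈ Icc (0 : ℝ) 1) :
    (∀ t, ‖_root_.steklovMean ε g t - g t‖ ≤ N * ε ^ β) ∧
      ∫⁻ t, ‖_root_.steklovMean ε g t - g t‖ₑ ≤ ENNReal.ofReal (N * ε ^ β) := by
  have hc := hg.continuous
  have hmem : ∀ a ∈ Icc (0 : ℝ) 1, ε * a ∈ Icc (0 : ℝ) 1 := fun a ha =>
    ⟨mul_nonneg hε.1 ha.1, mul_le_one₀ hε.2 ha.1 ha.2⟩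
  have hle : ∀ a ∈ Icc (0 : ℝ) 1, N * (ε * a) ^ β ≤ N * ε ^ β := fun a ha =>
    mul_le_mul_of_nonneg_left (Real.rpow_le_rpow (hmem a ha).1
      (mul_le_of_le_one_right hε.1 ha.2) hβ) hN
  simp only [steklovMean_sub hc]
  refine ⟨fun t => norm_unitIntegral_le fun a ha =>
    (hg.norm_sub_le _ (hmem a ha) t).trans (hle a ha), ?_⟩
  refine lintegral_enorm_unitIntegral_le (F := fun t a => g (t + ε * a) - g t)
    (by simp only [Function.uncurry_def]; fun_prop) fun a ha => ?_
  exact (hg.lintegral_sub_le _ (hmem a ha)).trans (ENNReal.ofReal_le_ofReal (hle a ha))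

theorem angularFourier_comp_add (g : ℝ → E) (b k : ℝ) :
    angularFourier (fun s => g (s + b)) k =
      Complex.exp (((k * b : ℝ) : ℂ) * Complex.I) • angularFourier g k := by
  have h := integral_add_right_eq_self (μ := volume)
    (fun s : ℝ => Complex.exp (-((k * s : ℝ) : ℂ) * Complex.I) • g s) b
  rw [angularFourier, angularFourier, ← h, ← integral_smul]
  refine integral_congr_ae (Eventually.of_forall fun s => ?_)
  simp only [smul_smul, ← Complex.exp_add]
  congr 2
  push_cast
  ring

/-- Translation by `εa` multiplies the transform by `e^{ikεa}`, so averaging over `a` multiplies it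
by an explicit scalar. That scalar is `O(1 / (ε|k|))`: each averaging gains one power of decay. -/
theorem angularFourier_steklovMean [CompleteSpace E] {g : ℝ → E} (hc : Continuous g)
    (hg : Integrable g) (ε k : ℝ) :
    angularFourier (steklovMean ε g) k =
      (∫ a in (0 : ℝ)..1, Complex.exp ((((k * ε : ℝ) : ℂ) * Complex.I) * a)) •
        angularFourier g k := by
  have hswap : ∫ a in (0 : ℝ)..1, ∫ s, Complex.exp (-((k * s : ℝ) : ℂ) * Complex.I) •
        g (s + ε * a) = angularFourier (steklovMean ε g) k := by
    rw [intervalIntegral_integral_swap]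
    · simp only [angularFourier, steklovMean, intervalIntegral.integral_smul]
    · refine ⟨Continuous.aestronglyMeasurable
        (by simp only [Function.uncurry_def]; fun_prop), ?_⟩
      rw [hasFiniteIntegral_iff_enorm, lintegral_prod _ (Continuous.aemeasurable
        (by simp only [Function.uncurry_def]; fun_prop))]
      have e : ∀ a s : ℝ, ‖Function.uncurry (fun a s : ℝ =>
          Complex.exp (-((k * s : ℝ) : ℂ) * Complex.I) • g (s + ε * a)) (a, s)‖ₑ =
          ‖g (s + ε * a)‖ₑ := by
        intro a s
        rw [← enorm_norm, Function.uncurry_apply_pair, norm_smul, norm_exp_neg_mul_I, one_mul,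
          enorm_norm]
      simp only [e]
      have e2 : ∀ a : ℝ, ∫⁻ s, ‖g (s + ε * a)‖ₑ = ∫⁻ s, ‖g s‖ₑ := fun a =>
        lintegral_add_right_eq_self (fun t => ‖g t‖ₑ) (ε * a)
      simp only [e2, lintegral_const]
      exact ENNReal.mul_lt_top hg.2 (by simp)
  rw [← hswap, ← intervalIntegral.integral_smul_const]
  refine intervalIntegral.integral_congr fun a _ => ?_
  have := angularFourier_comp_add g (ε * a) k
  rw [angularFourier] at this
  simp only [this]
  congr 2
  push_cast
  ring

theorem norm_angularFourier_steklovMean_le [CompleteSpace E] {g : ℝ → E} (hc : Continuous g)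
    (hg : Integrable g) {ε k : ℝ} (hε : 0 < ε) (hk : k ≠ 0) :
    ‖angularFourier (steklovMean ε g) k‖ ≤ 2 / (ε * |k|) * ‖angularFourier g k‖ := by
  rw [angularFourier_steklovMean hc hg, norm_smul]
  refine mul_le_mul_of_nonneg_right ?_ (norm_nonneg _)
  have hne : (((k * ε : ℝ) : ℂ) * Complex.I) ≠ 0 :=
    mul_ne_zero (Complex.ofReal_ne_zero.2 (mul_ne_zero hk hε.ne')) Complex.I_ne_zero
  rw [integral_exp_mul_complex hne, norm_div]
  have hd : ‖((k * ε : ℝ) : ℂ) * Complex.I‖ = ε * |k| := by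
    rw [norm_mul, Complex.norm_I, Complex.norm_real, Real.norm_eq_abs, abs_mul, abs_of_pos hε]
    ring
  rw [hd]
  refine div_le_div_of_nonneg_right ?_ (by positivity)
  refine (norm_sub_le _ _).trans ?_
  simp only [Complex.ofReal_one, mul_one, Complex.norm_exp_ofReal_mul_I, Complex.ofReal_zero,
    mul_zero, Complex.exp_zero, norm_one]
  norm_num

/-- The Dirichlet kernel `∫_{-R}^R e^{iku} dk`. -/
noncomputable def dirichletKernelReal (R u : ℝ) : ℂ :=
  ∫ k in (-R)..R, Complex.exp (((k * u : ℝ) : ℂ) * Complex.I)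

theorem norm_dirichletKernelReal_le {R : ℝ} (hR : 0 < R) (u : ℝ) :
    ‖dirichletKernelReal R u‖ ≤ 2 * R := by
  have := intervalIntegral.norm_integral_le_of_norm_le_const (a := -R) (b := R) (C := 1)
    (f := fun k : ℝ => Complex.exp (((k * u : ℝ) : ℂ) * Complex.I))
    fun k _ => (Complex.norm_exp_ofReal_mul_I _).le
  refine this.trans_eq ?_
  rw [one_mul, abs_of_pos (by linarith)]
  ring

theorem norm_dirichletKernelReal_le_inv (R : ℝ) {u : ℝ} (hu : u ≠ 0) :
    ‖dirichletKernelReal R u‖ ≤ 2 / |u| := by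
  have hne : (u : ℂ) * Complex.I ≠ 0 :=
    mul_ne_zero (Complex.ofReal_ne_zero.2 hu) Complex.I_ne_zero
  have e : dirichletKernelReal R u = ∫ k in (-R)..R, Complex.exp ((u : ℂ) * Complex.I * k) := by
    refine intervalIntegral.integral_congr fun k _ => ?_
    congr 1
    push_cast
    ring
  rw [e, integral_exp_mul_complex hne, norm_div, norm_mul, Complex.norm_I, mul_one,
    Complex.norm_real, Real.norm_eq_abs]
  refine div_le_div_of_nonneg_right ((norm_sub_le _ _).trans ?_) (abs_nonneg u)
  have h : ∀ k : ℝ, ‖Complex.exp ((u : ℂ) * Complex.I * k)‖ = 1 := by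
    intro k
    have := Complex.norm_exp_ofReal_mul_I (u * k)
    rw [← this]
    congr 2
    push_cast
    ring
  rw [h, h]
  norm_num

/-- Near `0` the bounds `2R` and `2/|u|` are interpolated with weights `δ` and `1 - δ`. The
resulting singularity `|u|^{δ-1}` is integrable, at the price of a factor `R^δ`; away from `0` the
second bound is at most `2`. -/
theorem norm_dirichletKernelReal_le_rpow {R δ u : ℝ} (hR : 0 < R) (hδ : δ ∈ Ioo (0 : ℝ) 1)
    (hu : u ≠ 0) : ‖dirichletKernelReal R u‖ ≤
      (Icc (-1 : ℝ) 1).indicator (fun u => 2 * R ^ δ * |u| ^ (δ - 1)) u + 2 := by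
  have hu' : 0 < |u| := abs_pos.2 hu
  have h2 := norm_dirichletKernelReal_le_inv R hu
  by_cases h : u ∈ Icc (-1 : ℝ) 1
  · rw [indicator_of_mem h]
    have h1 := norm_dirichletKernelReal_le hR u
    set x := ‖dirichletKernelReal R u‖ with hx
    have hx0 : 0 ≤ x := norm_nonneg _
    have e1 : x = x ^ δ * x ^ (1 - δ) := by
      rcases hx0.eq_or_lt with h0 | h0
      · rw [← h0, Real.zero_rpow hδ.1.ne', zero_mul]
      · rw [← Real.rpow_add h0]; simp
    have a1 : x ^ δ ≤ (2 * R) ^ δ := Real.rpow_le_rpow hx0 h1 hδ.1.le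
    have a2 : x ^ (1 - δ) ≤ (2 / |u|) ^ (1 - δ) :=
      Real.rpow_le_rpow hx0 h2 (by linarith [hδ.2])
    have : x ≤ (2 * R) ^ δ * (2 / |u|) ^ (1 - δ) := by
      rw [e1]
      exact mul_le_mul a1 a2 (by positivity) (by positivity)
    have e2 : (2 * R) ^ δ * (2 / |u|) ^ (1 - δ) = 2 * R ^ δ * |u| ^ (δ - 1) := by
      rw [Real.mul_rpow (by norm_num) hR.le, Real.div_rpow (by norm_num) hu'.le,
        ← neg_sub 1 δ, Real.rpow_neg hu'.le]
      have : (2 : ℝ) ^ δ * 2 ^ (1 - δ) = 2 := by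
        rw [← Real.rpow_add (by norm_num)]; simp
      calc _ = ((2 : ℝ) ^ δ * 2 ^ (1 - δ)) * R ^ δ * (|u| ^ (1 - δ))⁻¹ := by ring
        _ = _ := by rw [this]
    linarith
  · rw [indicator_of_notMem h, zero_add]
    refine h2.trans (div_le_self (by norm_num) ?_)
    by_contra hlt
    exact h (abs_le.1 (not_le.1 hlt).le)

theorem partialInversion_eq_dirichletKernelReal [CompleteSpace E] {g : ℝ → E} (hc : Continuous g)
    (hg : Integrable g) (R t : ℝ) : partialInversion g R t =
      (2 * Real.pi : ℂ)⁻¹ • ∫ s, dirichletKernelReal R (t - s) • g s := by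
  rw [partialInversion]
  congr 1
  have e : ∀ k : ℝ, Complex.exp (((k * t : ℝ) : ℂ) * Complex.I) • angularFourier g k =
      ∫ s, Complex.exp (((k * (t - s) : ℝ) : ℂ) * Complex.I) • g s := by
    intro k
    rw [angularFourier, ← integral_smul]
    refine integral_congr_ae (Eventually.of_forall fun s => ?_)
    simp only [smul_smul, ← Complex.exp_add]
    congr 2
    push_cast
    ring
  simp only [e]
  rw [intervalIntegral_integral_swap]
  · simp only [dirichletKernelReal, intervalIntegral.integral_smul_const]
  · refine ⟨Continuous.aestronglyMeasurable
      (by simp only [Function.uncurry_def]; fun_prop), ?_⟩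
    rw [hasFiniteIntegral_iff_enorm, lintegral_prod _ (Continuous.aemeasurable
      (by simp only [Function.uncurry_def]; fun_prop))]
    have e : ∀ k s : ℝ, ‖Function.uncurry (fun k s : ℝ =>
        Complex.exp (((k * (t - s) : ℝ) : ℂ) * Complex.I) • g s) (k, s)‖ₑ = ‖g s‖ₑ := by
      intro a s
      rw [← enorm_norm, Function.uncurry_apply_pair, norm_smul, Complex.norm_exp_ofReal_mul_I,
        one_mul, enorm_norm]
    simp only [e, lintegral_const]
    exact ENNReal.mul_lt_top hg.2 (by simp)

theorem integral_abs_rpow_Icc {δ : ℝ} (hδ : 0 < δ) :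
    IntegrableOn (fun u : ℝ => |u| ^ (δ - 1)) (Icc (-1) 1) ∧
      ∫ u in Icc (-1 : ℝ) 1, |u| ^ (δ - 1) = 2 / δ := by
  have hi : IntervalIntegrable (fun u : ℝ => |u| ^ (δ - 1)) volume 0 1 := by
    refine (intervalIntegral.intervalIntegrable_rpow' (r := δ - 1) (by linarith)).congr ?_
    intro u hu
    rw [uIoc_of_le zero_le_one] at hu
    simp only [abs_of_pos hu.1]
  have hi' : IntervalIntegrable (fun u : ℝ => |u| ^ (δ - 1)) volume (-1) 0 := by
    have := (IntervalIntegrable.comp_sub_left hi 0).symm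
    simpa using this
  have hv : ∫ u in (0 : ℝ)..1, |u| ^ (δ - 1) = 1 / δ := by
    have : ∫ u in (0 : ℝ)..1, |u| ^ (δ - 1) = ∫ u in (0 : ℝ)..1, u ^ (δ - 1) := by
      refine intervalIntegral.integral_congr fun u hu => ?_
      rw [uIcc_of_le zero_le_one] at hu
      simp only [abs_of_nonneg hu.1]
    rw [this, integral_rpow (Or.inl (by linarith))]
    simp [Real.zero_rpow hδ.ne']
  have hv' : ∫ u in (-1 : ℝ)..0, |u| ^ (δ - 1) = 1 / δ := by
    rw [← hv]
    have := intervalIntegral.integral_comp_neg (a := 0) (b := 1) (fun u : ℝ => |u| ^ (δ - 1))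
    simp only [abs_neg, neg_zero] at this
    exact this.symm
  constructor
  · rw [integrableOn_Icc_iff_integrableOn_Ioc]
    exact (intervalIntegrable_iff_integrableOn_Ioc_of_le (by norm_num)).1 (hi'.trans hi)
  · rw [integral_Icc_eq_integral_Ioc, ← intervalIntegral.integral_of_le (by norm_num),
      ← intervalIntegral.integral_add_adjacent_intervals hi' hi, hv, hv']
    ring

/-- No smoothness is needed here. The singular part of the kernel, of integral `(4/δ) R^δ`, is
paired with the supremum of `g`, and the bounded part with its `L¹` norm; this is why `HolderMean`
records both norms. -/
theorem norm_partialInversion_le [CompleteSpace E] {g : ℝ → E} (hc : Continuous g) {M : ℝ}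
    (hM : 0 ≤ M) (hsup : ∀ s, ‖g s‖ ≤ M) (hint : ∫⁻ s, ‖g s‖ₑ ≤ ENNReal.ofReal M) {δ R : ℝ}
    (hδ : δ ∈ Ioo (0 : ℝ) 1) (hR : 1 ≤ R) (t : ℝ) :
    ‖partialInversion g R t‖ ≤ 6 / δ * R ^ δ * M := by
  have hR0 : 0 < R := by linarith
  have hg := integrable_of_lintegral_enorm_le hc hint
  have hg1 := integral_norm_le_of_lintegral_enorm_le hc hM hint
  rw [partialInversion_eq_dirichletKernelReal hc hg, norm_smul]
  have hn : ‖(2 * Real.pi : ℂ)⁻¹‖ ≤ 1 := by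
    rw [norm_inv, norm_mul, Complex.norm_real, Complex.norm_ofNat, Real.norm_of_nonneg Real.pi_nonneg]
    apply inv_le_one_of_one_le₀
    nlinarith [Real.pi_gt_three]
  set φ : ℝ → ℝ := (Icc (-1 : ℝ) 1).indicator (fun u => 2 * R ^ δ * |u| ^ (δ - 1)) with hφ
  have hφi : Integrable φ :=
    IntegrableOn.integrable_indicator ((integral_abs_rpow_Icc hδ.1).1.const_mul (2 * R ^ δ))
      measurableSet_Icc
  have hφ0 : ∀ u, 0 ≤ φ u := fun u => indicator_nonneg (fun u _ => by positivity) u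
  have hφv : ∫ u, φ u = 4 / δ * R ^ δ := by
    rw [hφ, integral_indicator measurableSet_Icc, integral_const_mul,
      (integral_abs_rpow_Icc hδ.1).2]
    ring
  have hφt : Integrable fun s => M * φ (t - s) + 2 * ‖g s‖ :=
    ((hφi.comp_sub_left t).const_mul M).add (hg.norm.const_mul 2)
  have hb : ∀ᵐ s, ‖dirichletKernelReal R (t - s) • g s‖ ≤ M * φ (t - s) + 2 * ‖g s‖ := by
    have : ∀ᵐ s : ℝ, s ≠ t := by simp [ae_iff]
    filter_upwards [this] with s hs
    rw [norm_smul]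
    have h1 := norm_dirichletKernelReal_le_rpow hR0 hδ (sub_ne_zero.2 hs.symm)
    calc _ ≤ (φ (t - s) + 2) * ‖g s‖ := mul_le_mul_of_nonneg_right h1 (norm_nonneg _)
      _ = φ (t - s) * ‖g s‖ + 2 * ‖g s‖ := by ring
      _ ≤ φ (t - s) * M + 2 * ‖g s‖ := by gcongr; exacts [hφ0 _, hsup s]
      _ = _ := by ring
  have hmain := norm_integral_le_of_norm_le hφt hb
  rw [integral_add ((hφi.comp_sub_left t).const_mul M) (hg.norm.const_mul 2),
    integral_const_mul, integral_const_mul, integral_sub_left_eq_self φ volume t, hφv] at hmain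
  have hRδ : 1 ≤ R ^ δ := Real.one_le_rpow hR hδ.1.le
  have h2 : 2 * M ≤ 2 / δ * R ^ δ * M := by
    refine mul_le_mul_of_nonneg_right ?_ hM
    have : 2 ≤ 2 / δ := by rw [le_div_iff₀ hδ.1]; linarith [hδ.2]
    nlinarith
  calc _ ≤ 1 * ‖∫ s, dirichletKernelReal R (t - s) • g s‖ :=
        mul_le_mul_of_nonneg_right hn (norm_nonneg _)
    _ ≤ M * (4 / δ * R ^ δ) + 2 * ∫ s, ‖g s‖ := by rw [one_mul]; exact hmain
    _ ≤ M * (4 / δ * R ^ δ) + 2 / δ * R ^ δ * M := by linarith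
    _ = _ := by ring

theorem partialInversion_sub [CompleteSpace E] {g h : ℝ → E} (hg : Integrable g)
    (hh : Integrable h) (R t : ℝ) :
    partialInversion (fun s => g s - h s) R t = partialInversion g R t - partialInversion h R t := by
  have e : ∀ k, angularFourier (fun s => g s - h s) k = angularFourier g k - angularFourier h k := by
    intro k
    simp only [angularFourier, smul_sub]
    exact integral_sub (integrable_exp_smul hg k) (integrable_exp_smul hh k)
  have cg := continuous_angularFourier hg
  have ch := continuous_angularFourier hh
  simp only [partialInversion, e, smul_sub]
  rw [intervalIntegral.integral_sub (Continuous.intervalIntegrable (by fun_prop) _ _)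
      (Continuous.intervalIntegrable (by fun_prop) _ _), smul_sub]

/-- Fourier inversion for Hölder continuous functions, with a polynomial rate. -/
theorem HolderMean.norm_partialInversion_sub_le [CompleteSpace E] {g : ℝ → E} {β N : ℝ}
    (hg : HolderMean g β N) (hβ : β ∈ Ioc (0 : ℝ) 1) (hN : 0 ≤ N) {R : ℝ} (hR : 1 ≤ R) (t : ℝ) :
    ‖partialInversion g R t - g t‖ ≤ (102 / β) * N * R ^ (-(β / 8)) := by
  have hR0 : 0 < R := by linarith
  -- This scale makes `ε^β = R^{-β/4}`, which survives the loss `R^{β/8}`, while `1 / (ε² R) =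
  -- R^{-1/2}` is still small.
  set ε : ℝ := R ^ (-(1 / 4) : ℝ) with hεdef
  have hε0 : 0 < ε := Real.rpow_pos_of_pos hR0 _
  have hε1 : ε ≤ 1 := Real.rpow_le_one_of_one_le_of_nonpos hR (by norm_num)
  have hεm : ε ∈ Icc (0 : ℝ) 1 := ⟨hε0.le, hε1⟩
  set g₁ := _root_.steklovMean ε g with hg₁
  have H₁ : HolderMean g₁ β N := hg.steklovMean ε
  set g₂ := _root_.steklovMean ε g₁ with hg₂
  have H₂ : HolderMean g₂ β N := H₁.steklovMean ε
  obtain ⟨s1, i1⟩ := hg.steklovMean_sub_le hβ.1.le hN hεm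
  obtain ⟨s2, i2⟩ := H₁.steklovMean_sub_le hβ.1.le hN hεm
  rw [← hg₁] at s1 i1
  rw [← hg₂] at s2 i2
  have hεβ : ε ^ β = R ^ (-(β / 4)) := by
    rw [hεdef, ← Real.rpow_mul hR0.le]; congr 1; ring
  set r := R ^ (-(β / 8)) with hr
  have hr0 : 0 < r := Real.rpow_pos_of_pos hR0 _
  have hP : R ^ (β / 8) * R ^ (-(β / 4)) = r := by
    rw [← Real.rpow_add hR0, hr]; congr 1; ring
  have hle : ε ^ β ≤ r := by
    rw [hεβ]; exact Real.rpow_le_rpow_of_exponent_le hR (by linarith [hβ.1])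
  have hδ : β / 8 ∈ Ioo (0 : ℝ) 1 := ⟨by linarith [hβ.1], by linarith [hβ.2]⟩
  have hM : 0 ≤ N * ε ^ β := by positivity
  have p1 := norm_partialInversion_le (g := fun s => g₁ s - g s)
    (H₁.continuous.sub hg.continuous) hM s1 i1 hδ hR t
  have p2 := norm_partialInversion_le (g := fun s => g₂ s - g₁ s)
    (H₂.continuous.sub H₁.continuous) hM s2 i2 hδ hR t
  rw [partialInversion_sub H₁.integrable hg.integrable] at p1
  rw [partialInversion_sub H₂.integrable H₁.integrable] at p2
  have hq : 6 / (β / 8) * R ^ (β / 8) * (N * ε ^ β) = 48 / β * N * r := by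
    rw [hεβ, ← hP]; field_simp; ring
  rw [hq] at p1 p2
  -- Two averagings give two factors `2 / (ε|k|)`.
  have hC : ∀ k : ℝ, k ≠ 0 → ‖angularFourier g₂ k‖ ≤ (4 / ε ^ 2 * N) / k ^ 2 := by
    intro k hk
    have hk' : 0 < |k| := abs_pos.2 hk
    have a2 := norm_angularFourier_steklovMean_le H₁.continuous H₁.integrable hε0 hk
    have a1 := norm_angularFourier_steklovMean_le hg.continuous hg.integrable hε0 hk
    have a0 := (norm_angularFourier_le g k).trans
      (integral_norm_le_of_lintegral_enorm_le hg.continuous hN hg.lintegral_le)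
    calc _ ≤ 2 / (ε * |k|) * (2 / (ε * |k|) * N) := by
          refine a2.trans ?_
          gcongr
          exact a1.trans (by gcongr)
      _ = _ := by rw [← sq_abs k]; field_simp; ring
  have p3 := _root_.norm_partialInversion_sub_le H₂.continuous H₂.integrable hC hR0 t
  have hε2 : 4 / ε ^ 2 * N / R ≤ 4 * N * r := by
    have : (1 : ℝ) / ε ^ 2 / R = R ^ (-(1 / 2) : ℝ) := by
      have e : ε ^ 2 = R ^ (-(1 / 2) : ℝ) := by
        rw [hεdef, ← Real.rpow_natCast, ← Real.rpow_mul hR0.le]; norm_num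
      rw [e, Real.rpow_neg hR0.le, one_div, inv_inv]
      have : R = R ^ (1 / 2 : ℝ) * R ^ (1 / 2 : ℝ) := by
        rw [← Real.rpow_add hR0]; norm_num
      nth_rewrite 2 [this]
      have : R ^ (1 / 2 : ℝ) ≠ 0 := (Real.rpow_pos_of_pos hR0 _).ne'
      field_simp
    have h' : R ^ (-(1 / 2) : ℝ) ≤ r :=
      Real.rpow_le_rpow_of_exponent_le hR (by linarith [hβ.2])
    calc 4 / ε ^ 2 * N / R = 4 * N * (1 / ε ^ 2 / R) := by ring
      _ ≤ _ := by rw [this]; gcongr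
  have hNr : N * ε ^ β ≤ N * r := by gcongr
  have hβ1 : N * r ≤ 1 / β * N * r := by
    have : 1 ≤ 1 / β := by rw [le_div_iff₀ hβ.1]; linarith [hβ.2]
    nlinarith [mul_nonneg hN hr0.le]
  have hs1 := s1 t
  have hs2 := s2 t
  -- The five terms cost `48/β` twice for the partial inversions of the averaging errors, `4` for
  -- the inversion of `g₂`, and `1` twice for the averaging errors themselves. Since `1 ≤ 1/β`, the
  -- sum is at most `102/β`.
  have tri : partialInversion g R t - g t = -(partialInversion g₁ R t - partialInversion g R t)
      - (partialInversion g₂ R t - partialInversion g₁ R t) + (partialInversion g₂ R t - g₂ t)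
      + (g₂ t - g₁ t) + (g₁ t - g t) := by abel
  rw [tri]
  refine (norm_add_le_of_le (norm_add_le_of_le (norm_add_le_of_le (norm_sub_le_of_le
    ((norm_neg _).trans_le p1) p2) p3) hs2) hs1).trans ?_
  have : (102 / β) * N * r = 48 / β * N * r + 48 / β * N * r + 6 * (1 / β * N * r) := by ring
  rw [this]
  linarith

end HolderInversion

/-! ### Laplace integrals of exponentially bounded functions. -/

section LaplaceOfBounded

open MeasureTheory Set

variable {E : Type*} [NormedAddCommGroup E] [NormedSpace ℂ E]

theorem norm_laplace_integrand_le {f : ℝ → E} {C w s : ℝ}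
    (hb : ‖f s‖ ≤ C * Real.exp (w * s)) (z : ℂ) :
    ‖Complex.exp (-(z * s)) • f s‖ ≤ C * Real.exp (-(z.re - w) * s) := by
  rw [norm_smul, Complex.norm_exp]
  have : (-(z * (s : ℂ))).re = -(z.re * s) := by simp
  rw [this]
  calc _ ≤ Real.exp (-(z.re * s)) * (C * Real.exp (w * s)) := by gcongr
    _ = C * (Real.exp (-(z.re * s)) * Real.exp (w * s)) := by ring
    _ = _ := by rw [← Real.exp_add]; ring_nf

theorem aestronglyMeasurable_laplace_integrand {f : ℝ → E} (hf : ContinuousOn f (Ici 0)) (z : ℂ) :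
    AEStronglyMeasurable (fun s : ℝ => Complex.exp (-(z * s)) • f s)
      (volume.restrict (Ioi 0)) := by
  refine ContinuousOn.aestronglyMeasurable (ContinuousOn.smul ?_ (hf.mono Ioi_subset_Ici_self))
    measurableSet_Ioi
  fun_prop

theorem integrableOn_laplace {f : ℝ → E} (hf : ContinuousOn f (Ici 0)) {C w : ℝ}
    (hb : ∀ s, 0 ≤ s → ‖f s‖ ≤ C * Real.exp (w * s)) {z : ℂ} (hz : w < z.re) :
    IntegrableOn (fun s : ℝ => Complex.exp (-(z * s)) • f s) (Ioi 0) := by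
  have hi := (integrableOn_exp_mul_Ioi (a := -(z.re - w)) (by linarith) 0).const_mul C
  refine Integrable.mono' hi (aestronglyMeasurable_laplace_integrand hf z) ?_
  exact (ae_restrict_iff' measurableSet_Ioi).2 (Eventually.of_forall fun s hs =>
    norm_laplace_integrand_le (hb s (le_of_lt hs)) z)

theorem norm_integral_laplace_le {f : ℝ → E} {C w : ℝ}
    (hb : ∀ s, 0 ≤ s → ‖f s‖ ≤ C * Real.exp (w * s)) {z : ℂ} (hz : w < z.re) :
    ‖∫ s in Ioi (0 : ℝ), Complex.exp (-(z * s)) • f s‖ ≤ C / (z.re - w) := by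
  have hi := (integrableOn_exp_mul_Ioi (a := -(z.re - w)) (by linarith) 0).const_mul C
  refine (norm_integral_le_of_norm_le hi ((ae_restrict_iff' measurableSet_Ioi).2
    (Eventually.of_forall fun s hs => norm_laplace_integrand_le (hb s (le_of_lt hs)) z))).trans_eq ?_
  rw [integral_const_mul, integral_exp_mul_Ioi (by linarith), mul_zero, Real.exp_zero, neg_div_neg_eq,
    mul_one_div]

theorem continuousAt_laplace {f : ℝ → E} (hf : ContinuousOn f (Ici 0)) {C w : ℝ} (hC : 0 ≤ C)
    (hb : ∀ s, 0 ≤ s → ‖f s‖ ≤ C * Real.exp (w * s)) {z₀ : ℂ} (hz : w < z₀.re) :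
    ContinuousAt (fun z : ℂ => ∫ s in Ioi (0 : ℝ), Complex.exp (-(z * s)) • f s) z₀ := by
  -- The midpoint of `w` and `Re z₀` gives one dominating exponential valid for all `z` near `z₀`.
  have hi := (integrableOn_exp_mul_Ioi (a := -((w + z₀.re) / 2 - w)) (by linarith) 0).const_mul C
  refine continuousAt_of_dominated
    (Eventually.of_forall fun z => aestronglyMeasurable_laplace_integrand hf z) ?_ hi ?_
  · have : ∀ᶠ z : ℂ in 𝓝 z₀, (w + z₀.re) / 2 < z.re :=
      Complex.continuous_re.continuousAt.eventually (lt_mem_nhds (by linarith))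
    filter_upwards [this] with z hz'
    refine (ae_restrict_iff' measurableSet_Ioi).2 (Eventually.of_forall fun s hs => ?_)
    refine (norm_laplace_integrand_le (hb s (le_of_lt hs)) z).trans ?_
    have hs0 : 0 ≤ s := le_of_lt hs
    gcongr
  · exact Eventually.of_forall fun s => by fun_prop

theorem integral_Ioi_comp_add (F : ℝ → E) (h : ℝ) :
    ∫ s in Ioi (0 : ℝ), F (s + h) = ∫ s in Ioi h, F s := by
  have := (measurePreserving_add_right volume h).setIntegral_preimage_emb
    (measurableEmbedding_addRight h) F (Ioi h)
  rw [← this]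
  simp

end LaplaceOfBounded

/-! ### The resolvent of the generator as the Laplace transform of the semigroup. -/

namespace C0Semigroup

open MeasureTheory Set

variable {X : Type*} [NormedAddCommGroup X] [NormedSpace ℂ X]

theorem HasGrowthBound.exists_bound {S : C0Semigroup X} {ω₀ w : ℝ} (hS : S.HasGrowthBound ω₀)
    (hw : ω₀ < w) : ∃ C : ℝ, 1 ≤ C ∧ ∀ (t : ℝ), 0 ≤ t → ∀ y, ‖S.op t y‖ ≤
      C * ‖y‖ * Real.exp (w * t) := by
  obtain ⟨C, hC⟩ := hS w hw
  refine ⟨max C 1, le_max_right _ _, fun t ht y => ?_⟩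
  calc _ ≤ ‖S.op t‖ * ‖y‖ := (S.op t).le_opNorm y
    _ ≤ (max C 1 * Real.exp (w * t)) * ‖y‖ := by
        gcongr
        exact (hC t ht).trans (by gcongr; exact le_max_left _ _)
    _ = _ := by ring

theorem op_comm (S : C0Semigroup X) {s t : ℝ} (hs : 0 ≤ s) (ht : 0 ≤ t) (y : X) :
    S.op s (S.op t y) = S.op t (S.op s y) := by
  rw [← ContinuousLinearMap.comp_apply, ← S.op_add s t hs ht, add_comm, S.op_add t s ht hs,
    ContinuousLinearMap.comp_apply]

/-- The Laplace transform of the orbit of `y`. -/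
noncomputable def laplace (S : C0Semigroup X) (z : ℂ) (y : X) : X :=
  ∫ s in Ioi (0 : ℝ), Complex.exp (-(z * s)) • S.op s y

theorem HasGrowthBound.integrableOn {S : C0Semigroup X} {ω₀ : ℝ} (hS : S.HasGrowthBound ω₀)
    {z : ℂ} (hz : ω₀ < z.re) (y : X) :
    IntegrableOn (fun s : ℝ => Complex.exp (-(z * s)) • S.op s y) (Ioi 0) := by
  obtain ⟨w, h1, h2⟩ := exists_between hz
  obtain ⟨C, -, hC⟩ := hS.exists_bound h1
  exact integrableOn_laplace (S.continuousOn_orbit y) (fun s hs => hC s hs y) h2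

theorem HasGrowthBound.exists_laplace_bound {S : C0Semigroup X} {ω₀ ω : ℝ}
    (hS : S.HasGrowthBound ω₀) (hω : ω₀ < ω) :
    ∃ K : ℝ, ∀ z : ℂ, z.re = ω → ∀ y, ‖S.laplace z y‖ ≤ K * ‖y‖ := by
  obtain ⟨w, h1, h2⟩ := exists_between hω
  obtain ⟨C, -, hC⟩ := hS.exists_bound h1
  refine ⟨C / (ω - w), fun z hz y => ?_⟩
  refine (norm_integral_laplace_le (fun s hs => hC s hs y) (by rw [hz]; exact h2)).trans_eq ?_
  rw [hz]
  ring

theorem HasGrowthBound.exists_clm_laplace {S : C0Semigroup X} {ω₀ : ℝ} (hS : S.HasGrowthBound ω₀)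
    {z : ℂ} (hz : ω₀ < z.re) : ∃ B : X →L[ℂ] X, ∀ y, B y = S.laplace z y := by
  obtain ⟨K, hK⟩ := hS.exists_laplace_bound hz
  refine ⟨LinearMap.mkContinuous
    { toFun := S.laplace z
      map_add' := fun x y => ?_
      map_smul' := fun c y => ?_ } K fun y => hK z rfl y, fun y => rfl⟩
  · simp only [laplace, map_add, smul_add]
    exact integral_add (hS.integrableOn hz x) (hS.integrableOn hz y)
  · simp only [laplace, map_smul, RingHom.id_apply, smul_comm _ c]
    exact integral_smul c _

theorem generator_apply_of_hasGeneratorValue {S : C0Semigroup X} {x y : X}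
    (h : S.HasGeneratorValue x y) (hx : x ∈ S.generator.domain) : S.generator ⟨x, hx⟩ = y :=
  HasGeneratorValue.unique (Exists.choose_spec hx) h

theorem hasGeneratorValue_generator (S : C0Semigroup X) (x : S.generator.domain) :
    S.HasGeneratorValue (x : X) (S.generator x) :=
  Exists.choose_spec x.2

/-- Since `unboundedResolvent` is obtained by choice, uniqueness is what identifies it with the
Laplace transform. -/
theorem _root_.IsResolventAt.unique {A : X →ₗ.[ℂ] X} {z : ℂ} {B B' : X →L[ℂ] X}
    (h : IsResolventAt A z B) (h' : IsResolventAt A z B') : B = B' := by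
  ext x
  obtain ⟨hx, e⟩ := h.1 x
  have := h'.2 ⟨B x, hx⟩
  simp only [e] at this
  exact this.symm

variable [CompleteSpace X]

theorem HasGrowthBound.op_laplace {S : C0Semigroup X} {ω₀ : ℝ} (hS : S.HasGrowthBound ω₀)
    {z : ℂ} (hz : ω₀ < z.re) {h : ℝ} (hh : 0 ≤ h) (y : X) :
    S.op h (S.laplace z y) = S.laplace z (S.op h y) := by
  rw [laplace, ← ContinuousLinearMap.integral_comp_comm _ (hS.integrableOn hz y), laplace]
  refine setIntegral_congr_fun measurableSet_Ioi fun s hs => ?_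
  simp only [map_smul]
  rw [S.op_comm hh (le_of_lt hs)]

/-- Shifting the integration variable gives `S(h) L = e^{zh} (L - ∫₀ʰ F)` for the Laplace integral
`L`; the right side is differentiable at `h = 0` with derivative `zL - y`. -/
theorem HasGrowthBound.hasGeneratorValue_laplace {S : C0Semigroup X} {ω₀ : ℝ}
    (hS : S.HasGrowthBound ω₀) {z : ℂ} (hz : ω₀ < z.re) (y : X) :
    S.HasGeneratorValue (S.laplace z y) (z • S.laplace z y - y) := by
  -- The values of `S.op` at negative times are arbitrary; `max s 0` gives a continuous integrand on
  -- all of `ℝ`, so the two-sided derivative is available.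
  set F : ℝ → X := fun s => Complex.exp (-(z * s)) • S.op (max s 0) y with hF
  have hFc : Continuous F := by
    have : Continuous fun s : ℝ => S.op (max s 0) y :=
      (S.continuousOn_orbit y).comp_continuous (by fun_prop) fun s => le_max_right s 0
    fun_prop
  have hFi : IntegrableOn F (Ioi 0) := (hS.integrableOn hz y).congr_fun
    (fun s hs => by simp only [hF, max_eq_left (le_of_lt (mem_Ioi.1 hs))]) measurableSet_Ioi
  have hFl : S.laplace z y = ∫ s in Ioi 0, F s := setIntegral_congr_fun measurableSet_Ioi
    fun s hs => by simp only [hF, max_eq_left (le_of_lt (mem_Ioi.1 hs))]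
  have hshift : ∀ h : ℝ, 0 ≤ h → S.op h (S.laplace z y) =
      Complex.exp (z * h) • (S.laplace z y - ∫ s in (0 : ℝ)..h, F s) := by
    intro h hh
    rw [← intervalIntegral.integral_Ioi_sub_Ioi hFi hh, ← hFl, sub_sub_cancel,
      ← integral_Ioi_comp_add, ← integral_smul, laplace,
      ← ContinuousLinearMap.integral_comp_comm _ (hS.integrableOn hz y)]
    refine setIntegral_congr_fun measurableSet_Ioi fun s hs => ?_
    have hs0 : 0 ≤ s := le_of_lt hs
    simp only [hF, map_smul, smul_smul, ← Complex.exp_add, max_eq_left (add_nonneg hs0 hh)]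
    rw [add_comm s h, S.op_add h s hh hs0, ContinuousLinearMap.comp_apply]
    congr 2
    push_cast
    ring
  have hd : HasDerivAt (fun h : ℝ => Complex.exp (z * h) •
      (S.laplace z y - ∫ s in (0 : ℝ)..h, F s)) (z • S.laplace z y - y) 0 := by
    have h1 : HasDerivAt (fun h : ℝ => Complex.exp (z * h)) z 0 := by
      have := ((hasDerivAt_id (0 : ℝ)).ofReal_comp.const_mul z).cexp
      simpa using this
    have h2 : HasDerivAt (fun h : ℝ => S.laplace z y - ∫ s in (0 : ℝ)..h, F s) (-F 0) 0 :=
      (hFc.integral_hasStrictDerivAt 0 0).hasDerivAt.const_sub _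
    have h3 := h1.smul h2
    have hF0 : F 0 = y := by simp [hF, S.op_zero]
    refine h3.congr_deriv ?_
    simp [hF0, add_comm, sub_eq_add_neg]
  have ht := hd.tendsto_slope_zero_right
  refine ht.congr' ?_
  filter_upwards [self_mem_nhdsWithin] with h hh
  rw [zero_add, ← hshift h (le_of_lt hh)]
  simp only [Complex.ofReal_zero, mul_zero, Complex.exp_zero, intervalIntegral.integral_same,
    sub_zero, one_smul]
  rw [← Complex.coe_smul, Complex.ofReal_inv]

theorem HasGrowthBound.isResolventAt {S : C0Semigroup X} {ω₀ : ℝ} (hS : S.HasGrowthBound ω₀)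
    {z : ℂ} (hz : ω₀ < z.re) {B : X →L[ℂ] X} (hB : ∀ y, B y = S.laplace z y) :
    IsResolventAt S.generator z B := by
  have hg : ∀ y, S.HasGeneratorValue (B y) (z • B y - y) := fun y => by
    rw [hB]; exact hS.hasGeneratorValue_laplace hz y
  refine ⟨fun y => ?_, fun y => ?_⟩
  · have hy : B y ∈ S.generator.domain := ⟨_, hg y⟩
    refine ⟨hy, ?_⟩
    rw [generator_apply_of_hasGeneratorValue (hg y)]
    abel
  -- For the left inverse: `B` is continuous and commutes with `S(h)`, so it carries the difference
  -- quotients of `y` to those of `B y`. Comparing the two generator values of `B y` finishes.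
  · have h1 : S.HasGeneratorValue (B y) (B (S.generator y)) := by
      have h0 := (B.continuous.tendsto _).comp (S.hasGeneratorValue_generator y)
      refine Tendsto.congr' ?_ h0
      filter_upwards [self_mem_nhdsWithin] with h hh
      simp only [Function.comp_apply, map_smul, map_sub]
      rw [hB (S.op h y), ← hS.op_laplace hz (le_of_lt hh), hB]
    have := (hg y).unique h1
    rw [map_sub, map_smul, ← this]
    abel

theorem HasGrowthBound.mem_unboundedResolventSet {S : C0Semigroup X} {ω₀ : ℝ}
    (hS : S.HasGrowthBound ω₀) {z : ℂ} (hz : ω₀ < z.re) :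
    z ∈ unboundedResolventSet S.generator := by
  obtain ⟨B, hB⟩ := hS.exists_clm_laplace hz
  exact ⟨B, hS.isResolventAt hz hB⟩

theorem HasGrowthBound.unboundedResolvent_apply {S : C0Semigroup X} {ω₀ : ℝ}
    (hS : S.HasGrowthBound ω₀) {z : ℂ} (hz : ω₀ < z.re) (y : X) :
    unboundedResolvent S.generator z y = S.laplace z y := by
  obtain ⟨B, hB⟩ := hS.exists_clm_laplace hz
  have hmem := hS.mem_unboundedResolventSet hz
  rw [unboundedResolvent, dif_pos hmem, hmem.choose_spec.unique (hS.isResolventAt hz hB), hB]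

theorem HasGrowthBound.continuousOn_unboundedResolvent {S : C0Semigroup X} {ω₀ : ℝ}
    (hS : S.HasGrowthBound ω₀) (y : X) :
    ContinuousOn (fun z : ℂ => unboundedResolvent S.generator z y) {z : ℂ | ω₀ < z.re} := by
  refine ContinuousOn.congr (f := fun z => S.laplace z y) ?_
    fun z hz => hS.unboundedResolvent_apply hz y
  intro z hz
  obtain ⟨w, h1, h2⟩ := exists_between (show ω₀ < z.re from hz)
  obtain ⟨C, hC1, hC⟩ := hS.exists_bound h1
  exact (continuousAt_laplace (S.continuousOn_orbit y) (by positivity)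
    (fun s hs => hC s hs y) h2).continuousWithinAt

theorem HasGrowthBound.continuous_unboundedResolvent_line {S : C0Semigroup X} {ω₀ ω : ℝ}
    (hS : S.HasGrowthBound ω₀) (hω : ω₀ < ω) (y : X) :
    Continuous fun k : ℝ => unboundedResolvent S.generator ((ω : ℂ) + k * Complex.I) y :=
  (hS.continuousOn_unboundedResolvent y).comp_continuous
    (f := fun k : ℝ => (ω : ℂ) + k * Complex.I) (by fun_prop) fun k => by simpa using hω

/-- The truncated inversion integrals of the resolvent are bounded operators which commute with
the semigroup. -/
theorem HasGrowthBound.exists_clm_inversionIntegral {S : C0Semigroup X} {ω₀ ω : ℝ}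
    (hS : S.HasGrowthBound ω₀) (hω : ω₀ < ω) (R t : ℝ) :
    ∃ V : X →L[ℂ] X, (∀ y, V y =
        inversionIntegral (fun z => unboundedResolvent S.generator z y) ω R t) ∧
      ∀ h, 0 ≤ h → ∀ y, S.op h (V y) = V (S.op h y) := by
  have hre : ∀ k : ℝ, ω₀ < ((ω : ℂ) + k * Complex.I).re := fun k => by simpa using hω
  have hint : ∀ y, IntervalIntegrable (fun k : ℝ =>
      (Complex.exp (((ω : ℂ) + k * Complex.I) * t) * Complex.I) •
        unboundedResolvent S.generator ((ω : ℂ) + k * Complex.I) y) volume (-R) R := fun y => by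
    have := hS.continuous_unboundedResolvent_line hω y
    exact Continuous.intervalIntegrable (by fun_prop) _ _
  obtain ⟨K, hK⟩ := hS.exists_laplace_bound hω
  refine ⟨LinearMap.mkContinuous
    { toFun := fun y => inversionIntegral (fun z => unboundedResolvent S.generator z y) ω R t
      map_add' := fun x y => ?_
      map_smul' := fun c y => ?_ }
    (‖(2 * (Real.pi : ℂ) * Complex.I)⁻¹‖ * (Real.exp (ω * t) * K * |R - -R|)) fun y => ?_,
    fun y => rfl, fun h hh y => ?_⟩
  · simp only [inversionIntegral, map_add, smul_add]
    rw [intervalIntegral.integral_add (hint x) (hint y), smul_add]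
  · simp only [inversionIntegral, map_smul, RingHom.id_apply, smul_comm _ c]
    rw [intervalIntegral.integral_smul, smul_comm]
  · simp only [LinearMap.coe_mk, AddHom.coe_mk, inversionIntegral, norm_smul]
    have hk : ∀ k ∈ uIoc (-R) R, ‖(Complex.exp (((ω : ℂ) + k * Complex.I) * t) * Complex.I) •
        unboundedResolvent S.generator ((ω : ℂ) + k * Complex.I) y‖ ≤
          Real.exp (ω * t) * (K * ‖y‖) := by
      intro k _
      rw [norm_smul, norm_mul, Complex.norm_I, mul_one, Complex.norm_exp,
        hS.unboundedResolvent_apply (hre k)]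
      have : (((ω : ℂ) + k * Complex.I) * t).re = ω * t := by simp
      rw [this]
      gcongr
      exact hK _ (by simp) y
    rw [mul_assoc ‖_‖]
    refine mul_le_mul_of_nonneg_left ?_ (norm_nonneg _)
    refine (intervalIntegral.norm_integral_le_of_norm_le_const hk).trans_eq ?_
    ring
  · simp only [LinearMap.mkContinuous_apply, LinearMap.coe_mk, AddHom.coe_mk, inversionIntegral,
      map_smul]
    rw [← ContinuousLinearMap.intervalIntegral_comp_comm _ (hint y)]
    congr 1
    refine intervalIntegral.integral_congr fun k _ => ?_
    simp only [map_smul]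
    rw [hS.unboundedResolvent_apply (hre k), hS.unboundedResolvent_apply (hre k),
      hS.op_laplace (hre k) hh]

end C0Semigroup

/-! ### The corrected orbit: Hölder estimates, its transform, and the inversion rate. -/

namespace C0Semigroup

open MeasureTheory Set

variable {X : Type*} [NormedAddCommGroup X] [NormedSpace ℂ X]

theorem _root_.Real.abs_exp_sub_one_le_mul_exp (x : ℝ) :
    |Real.exp x - 1| ≤ |x| * Real.exp |x| := by
  have h1 := Real.add_one_le_exp x
  have h2 := Real.add_one_le_exp (-x)
  have h3 : Real.exp x * Real.exp (-x) = 1 := by rw [← Real.exp_add]; simp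
  have h4 : Real.exp x - 1 ≤ x * Real.exp x := by nlinarith [Real.exp_pos x]
  have h5 : (1 : ℝ) ≤ Real.exp |x| := Real.one_le_exp (abs_nonneg x)
  rw [abs_le]
  constructor
  · nlinarith [neg_abs_le x, abs_nonneg x]
  · exact h4.trans (mul_le_mul (le_abs_self x) (Real.exp_le_exp.2 (le_abs_self x))
      (Real.exp_pos x).le (abs_nonneg x))

theorem _root_.lintegral_enorm_le_of_exp_decay {E : Type*} [NormedAddCommGroup E] {g : ℝ → E} {γ c : ℝ} (hγ : 0 < γ)
    (hg : ∀ s, ‖g s‖ ≤ c * (Ioi (-1 : ℝ)).indicator (fun s => Real.exp (-γ * s)) s) :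
    ∫⁻ s, ‖g s‖ₑ ≤ ENNReal.ofReal (c * (Real.exp γ / γ)) := by
  have hi : Integrable fun s => c * (Ioi (-1 : ℝ)).indicator (fun s => Real.exp (-γ * s)) s :=
    ((integrableOn_exp_mul_Ioi (by linarith) _).integrable_indicator measurableSet_Ioi).const_mul c
  have hv : ∫ s, c * (Ioi (-1 : ℝ)).indicator (fun s => Real.exp (-γ * s)) s =
      c * (Real.exp γ / γ) := by
    rw [integral_const_mul, integral_indicator measurableSet_Ioi,
      integral_exp_mul_Ioi (by linarith)]
    simp
  rw [← hv, ofReal_integral_eq_lintegral_ofReal hi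
    (Eventually.of_forall fun s => (norm_nonneg _).trans (hg s))]
  refine lintegral_mono fun s => ?_
  rw [← ofReal_norm]
  exact ENNReal.ofReal_le_ofReal (hg s)

/-- The rescaled orbit of `y`, corrected so as to vanish at time `0`, and extended by `0` to
negative times. -/
noncomputable def correctedOrbit (S : C0Semigroup X) (ω₀ ω : ℝ) (y : X) (s : ℝ) : X :=
  Real.exp (-ω * max s 0) • (S.op (max s 0) y - Real.exp (ω₀ * max s 0) • y)

theorem continuous_correctedOrbit (S : C0Semigroup X) (ω₀ ω : ℝ) (y : X) :
    Continuous (S.correctedOrbit ω₀ ω y) := by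
  have : Continuous fun s : ℝ => S.op (max s 0) y :=
    (S.continuousOn_orbit y).comp_continuous (by fun_prop) fun s => le_max_right s 0
  unfold correctedOrbit
  fun_prop

theorem correctedOrbit_of_nonneg (S : C0Semigroup X) (ω₀ ω : ℝ) (y : X) {s : ℝ} (hs : 0 ≤ s) :
    S.correctedOrbit ω₀ ω y s = Real.exp (-ω * s) • (S.op s y - Real.exp (ω₀ * s) • y) := by
  rw [correctedOrbit, max_eq_left hs]

theorem correctedOrbit_of_nonpos (S : C0Semigroup X) (ω₀ ω : ℝ) (y : X) {s : ℝ} (hs : s ≤ 0) :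
    S.correctedOrbit ω₀ ω y s = 0 := by
  rw [correctedOrbit, max_eq_right hs]
  simp [S.op_zero]

/-- The exponential factor turns pointwise Hölder bounds into `L¹` ones. It comes from a growth rate
`w` strictly between `ω₀` and `ω`, with `γ = ω - w`. The constant `K` does not depend on `y` or `N`,
which the Favard estimate requires. -/
theorem HasGrowthBound.exists_correctedOrbit_increment {S : C0Semigroup X} {ω₀ ω β : ℝ}
    (hS : S.HasGrowthBound ω₀) (hω : ω₀ < ω) (hβ : β ∈ Ioc (0 : ℝ) 1) :
    ∃ γ K : ℝ, 0 < γ ∧ 0 ≤ K ∧ ∀ (y : X) (N : ℝ), ‖y‖ ≤ N →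
      (∀ h ∈ Icc (0 : ℝ) 1, ‖S.op h y - y‖ ≤ N * h ^ β) →
      (∀ p, 0 ≤ p → ‖S.correctedOrbit ω₀ ω y p‖ ≤ K * N * Real.exp (-γ * p)) ∧
      ∀ p, 0 ≤ p → ∀ q ∈ Icc (0 : ℝ) 1,
        ‖S.correctedOrbit ω₀ ω y (p + q) - S.correctedOrbit ω₀ ω y p‖ ≤
          K * N * q ^ β * Real.exp (-γ * p) := by
  obtain ⟨w, h1, h2⟩ := exists_between hω
  obtain ⟨C, hC1, hC⟩ := hS.exists_bound h1
  have hCω : ∀ p, 0 ≤ p → ∀ y, Real.exp (-ω * p) * ‖S.op p y‖ ≤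
      C * ‖y‖ * Real.exp (-(ω - w) * p) := by
    intro p hp y
    calc _ ≤ Real.exp (-ω * p) * (C * ‖y‖ * Real.exp (w * p)) := by gcongr; exact hC p hp y
      _ = C * ‖y‖ * (Real.exp (-ω * p) * Real.exp (w * p)) := by ring
      _ = _ := by rw [← Real.exp_add]; ring_nf
  have hexp : ∀ p : ℝ, 0 ≤ p → Real.exp (-ω * p) * Real.exp (ω₀ * p) ≤
      Real.exp (-(ω - w) * p) := by
    intro p hp
    rw [← Real.exp_add]
    apply Real.exp_le_exp.2
    nlinarith
  set L : ℝ := |ω| * Real.exp |ω| with hL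
  set L' : ℝ := |ω₀ - ω| * Real.exp |ω₀ - ω| with hL'
  have hlip : ∀ c : ℝ, ∀ q ∈ Icc (0 : ℝ) 1, |Real.exp (c * q) - 1| ≤
      |c| * Real.exp |c| * q ^ β := by
    intro c q hq
    have hq' : q ≤ q ^ β := by
      simpa using Real.rpow_le_rpow_of_exponent_ge' hq.1 hq.2 hβ.1.le hβ.2
    refine (Real.abs_exp_sub_one_le_mul_exp _).trans ?_
    rw [abs_mul, abs_of_nonneg hq.1]
    have hqβ : 0 ≤ q ^ β := Real.rpow_nonneg hq.1 _
    have : Real.exp (|c| * q) ≤ Real.exp |c| :=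
      Real.exp_le_exp.2 (mul_le_of_le_one_right (abs_nonneg c) hq.2)
    calc |c| * q * Real.exp (|c| * q) ≤ |c| * q ^ β * Real.exp |c| := by gcongr
      _ = _ := by ring
  have hL0 : 0 ≤ L := by positivity
  have hL0' : 0 ≤ L' := by positivity
  -- The three summands of `K` serve the size bound, the semigroup part of the increment and its
  -- scalar part.
  refine ⟨ω - w, (C + 1) + C * (Real.exp |ω| + L) + L', by linarith, by positivity,
    fun y N hy hN => ⟨fun p hp => ?_, fun p hp q hq => ?_⟩⟩
  · have hN0 : 0 ≤ N := (norm_nonneg _).trans hy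
    rw [S.correctedOrbit_of_nonneg _ _ _ hp, norm_smul, Real.norm_of_nonneg (Real.exp_pos _).le]
    have a : ‖S.op p y - Real.exp (ω₀ * p) • y‖ ≤ ‖S.op p y‖ + Real.exp (ω₀ * p) * ‖y‖ := by
      refine (norm_sub_le _ _).trans_eq ?_
      rw [norm_smul, Real.norm_of_nonneg (Real.exp_pos _).le]
    calc _ ≤ Real.exp (-ω * p) * (‖S.op p y‖ + Real.exp (ω₀ * p) * ‖y‖) := by gcongr
      _ = Real.exp (-ω * p) * ‖S.op p y‖ + Real.exp (-ω * p) * Real.exp (ω₀ * p) * ‖y‖ := by ring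
      _ ≤ C * N * Real.exp (-(ω - w) * p) + Real.exp (-(ω - w) * p) * N := by
          have a1 : C * ‖y‖ * Real.exp (-(ω - w) * p) ≤ C * N * Real.exp (-(ω - w) * p) := by
            gcongr
          exact add_le_add ((hCω p hp y).trans a1)
            (mul_le_mul (hexp p hp) hy (norm_nonneg _) (Real.exp_pos _).le)
      _ = (C + 1) * (N * Real.exp (-(ω - w) * p)) := by ring
      _ ≤ ((C + 1) + C * (Real.exp |ω| + L) + L') * (N * Real.exp (-(ω - w) * p)) := by
          refine mul_le_mul_of_nonneg_right ?_ (by positivity)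
          have : 0 ≤ C * (Real.exp |ω| + L) := by positivity
          linarith
      _ = _ := by ring
  · have hN0 : 0 ≤ N := (norm_nonneg _).trans hy
    have hqβ : 0 ≤ q ^ β := Real.rpow_nonneg hq.1 _
    -- This is `v = e^{-ωq} S(q)y - y`, so that `e^{-ωp} S(p) v` is the increment of the rescaled
    -- orbit before correction.
    set v : X := Real.exp (-ω * q) • (S.op q y - y) + (Real.exp (-ω * q) - 1) • y with hv
    have hvn : ‖v‖ ≤ (Real.exp |ω| + L) * N * q ^ β := by
      have e1 : Real.exp (-ω * q) ≤ Real.exp |ω| := by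
        apply Real.exp_le_exp.2
        nlinarith [neg_abs_le ω, abs_nonneg ω, hq.1, hq.2]
      have e2 := hlip (-ω) q hq
      rw [abs_neg] at e2
      calc ‖v‖ ≤ Real.exp (-ω * q) * ‖S.op q y - y‖ + |Real.exp (-ω * q) - 1| * ‖y‖ := by
            refine (norm_add_le _ _).trans_eq ?_
            rw [norm_smul, norm_smul, Real.norm_of_nonneg (Real.exp_pos _).le, Real.norm_eq_abs]
        _ ≤ Real.exp |ω| * (N * q ^ β) + L * q ^ β * N := by
            gcongr
            exact hN q hq
        _ = _ := by ring
    have hpq : S.correctedOrbit ω₀ ω y (p + q) - S.correctedOrbit ω₀ ω y p =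
        Real.exp (-ω * p) • S.op p v -
          (Real.exp (-ω * p) * Real.exp (ω₀ * p) * (Real.exp ((ω₀ - ω) * q) - 1)) • y := by
      rw [S.correctedOrbit_of_nonneg _ _ _ hp, S.correctedOrbit_of_nonneg _ _ _
        (add_nonneg hp hq.1), S.op_add p q hp hq.1, ContinuousLinearMap.comp_apply, hv]
      have e3 : Real.exp (-ω * (p + q)) = Real.exp (-ω * p) * Real.exp (-ω * q) := by
        rw [← Real.exp_add]; ring_nf
      have e4 : Real.exp (ω₀ * (p + q)) = Real.exp (ω₀ * p) * Real.exp (ω₀ * q) := by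
        rw [← Real.exp_add]; ring_nf
      have e5 : Real.exp ((ω₀ - ω) * q) = Real.exp (ω₀ * q) * Real.exp (-ω * q) := by
        rw [← Real.exp_add]; ring_nf
      rw [e3, e4, e5]
      simp only [map_add, map_sub, ContinuousLinearMap.map_smul_of_tower]
      module
    rw [hpq]
    have b1 : ‖Real.exp (-ω * p) • S.op p v‖ ≤ C * ((Real.exp |ω| + L) * N * q ^ β) *
        Real.exp (-(ω - w) * p) := by
      rw [norm_smul, Real.norm_of_nonneg (Real.exp_pos _).le]
      exact (hCω p hp v).trans (by gcongr)
    have b2 : ‖(Real.exp (-ω * p) * Real.exp (ω₀ * p) * (Real.exp ((ω₀ - ω) * q) - 1)) • y‖ ≤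
        Real.exp (-(ω - w) * p) * (L' * q ^ β) * N := by
      rw [norm_smul, norm_mul, Real.norm_of_nonneg (by positivity), Real.norm_eq_abs]
      gcongr
      · exact hexp p hp
      · exact hlip _ q hq
    refine (norm_sub_le_of_le b1 b2).trans ?_
    calc _ = (C * (Real.exp |ω| + L) + L') * (N * q ^ β * Real.exp (-(ω - w) * p)) := by ring
      _ ≤ ((C + 1) + C * (Real.exp |ω| + L) + L') * (N * q ^ β * Real.exp (-(ω - w) * p)) := by
          refine mul_le_mul_of_nonneg_right ?_ (by positivity)
          linarith
      _ = _ := by ring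

theorem HasGrowthBound.exists_holderMean_correctedOrbit {S : C0Semigroup X} {ω₀ ω β : ℝ}
    (hS : S.HasGrowthBound ω₀) (hω : ω₀ < ω) (hβ : β ∈ Ioc (0 : ℝ) 1) :
    ∃ K : ℝ, 0 ≤ K ∧ ∀ (y : X) (N : ℝ), ‖y‖ ≤ N →
      (∀ h ∈ Icc (0 : ℝ) 1, ‖S.op h y - y‖ ≤ N * h ^ β) →
      HolderMean (S.correctedOrbit ω₀ ω y) β (K * N) := by
  obtain ⟨γ, K, hγ, hK, H⟩ := hS.exists_correctedOrbit_increment hω hβ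
  -- `J` is the integral of `e^{-γs}` over `s > -1`. The window starts at `-1` because the increment
  -- at `s` with step `h ≤ 1` can be nonzero only when `s + h > 0`.
  set J : ℝ := Real.exp γ / γ with hJ
  have hJ0 : 0 < J := by positivity
  refine ⟨K * (1 + J), by positivity, fun y N hy hN => ?_⟩
  have hN0 : 0 ≤ N := (norm_nonneg _).trans hy
  obtain ⟨H1, H2⟩ := H y N hy hN
  have hle : K * N * J ≤ K * (1 + J) * N := by
    have : 0 ≤ K * N := by positivity
    nlinarith
  have hle' : K * N ≤ K * (1 + J) * N := by
    have : 0 ≤ K * N * J := by positivity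
    nlinarith
  have hinc : ∀ h ∈ Icc (0 : ℝ) 1, ∀ s,
      ‖S.correctedOrbit ω₀ ω y (s + h) - S.correctedOrbit ω₀ ω y s‖ ≤
        K * N * h ^ β * Real.exp (-γ * max s 0) := by
    intro h hh s
    have hhβ : 0 ≤ h ^ β := Real.rpow_nonneg hh.1 _
    rcases le_total 0 s with hs | hs
    · rw [max_eq_left hs]
      exact H2 s hs h hh
    · rw [max_eq_right hs, S.correctedOrbit_of_nonpos _ _ _ hs, sub_zero, mul_zero, Real.exp_zero,
        mul_one]
      rcases le_total 0 (s + h) with hsh | hsh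
      -- When the step crosses `0`, only its positive part `s + h ≤ h` counts, because the corrected
      -- orbit vanishes at `0`.
      · have := H2 0 le_rfl (s + h) ⟨hsh, by linarith [hh.2]⟩
        rw [zero_add, S.correctedOrbit_of_nonpos _ _ _ le_rfl, sub_zero, mul_zero, Real.exp_zero,
          mul_one] at this
        refine this.trans ?_
        gcongr
        · exact hβ.1.le
        · linarith
      · rw [S.correctedOrbit_of_nonpos _ _ _ hsh, norm_zero]
        positivity
  refine ⟨S.continuous_correctedOrbit _ _ _, ?_, fun h hh s => ?_, fun h hh => ?_⟩
  · refine (lintegral_enorm_le_of_exp_decay (c := K * N) hγ fun s => ?_).trans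
      (ENNReal.ofReal_le_ofReal hle)
    rcases le_total 0 s with hs | hs
    · rw [indicator_of_mem (by simp; linarith)]
      exact H1 s hs
    · rw [S.correctedOrbit_of_nonpos _ _ _ hs, norm_zero]
      exact mul_nonneg (by positivity) (indicator_nonneg (fun _ _ => (Real.exp_pos _).le) _)
  · have hhβ : 0 ≤ h ^ β := Real.rpow_nonneg hh.1 _
    refine (hinc h hh s).trans ?_
    have : Real.exp (-γ * max s 0) ≤ 1 := by
      apply Real.exp_le_one_iff.2
      nlinarith [le_max_right s 0]
    calc _ ≤ K * N * h ^ β * 1 := by gcongr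
      _ = K * N * h ^ β := by ring
      _ ≤ _ := by gcongr
  · have hhβ : 0 ≤ h ^ β := Real.rpow_nonneg hh.1 _
    refine (lintegral_enorm_le_of_exp_decay (c := K * N * h ^ β) hγ fun s => ?_).trans
      (ENNReal.ofReal_le_ofReal ?_)
    · by_cases hs : s ∈ Ioi (-1 : ℝ)
      · rw [indicator_of_mem hs]
        refine (hinc h hh s).trans ?_
        have : Real.exp (-γ * max s 0) ≤ Real.exp (-γ * s) :=
          Real.exp_le_exp.2 (by nlinarith [le_max_left s 0])
        gcongr
      · have hs' : s ≤ -1 := not_lt.1 hs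
        rw [S.correctedOrbit_of_nonpos _ _ _ (by linarith [hh.2] : s + h ≤ 0),
          S.correctedOrbit_of_nonpos _ _ _ (by linarith), sub_zero, norm_zero]
        exact mul_nonneg (by positivity) (indicator_nonneg (fun _ _ => (Real.exp_pos _).le) _)
    · calc K * N * h ^ β * J = K * N * J * h ^ β := by ring
        _ ≤ _ := by gcongr

theorem _root_.integral_cexp_neg_mul_Ioi {z : ℂ} (hz : 0 < z.re) :
    ∫ s in Ioi (0 : ℝ), Complex.exp (-(z * s)) = z⁻¹ := by
  have := integral_exp_mul_complex_Ioi (a := -z) (by simpa using hz) 0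
  simp only [neg_mul] at this
  rw [this]
  simp [neg_div_neg_eq]

theorem HasGrowthBound.angularFourier_correctedOrbit [CompleteSpace X] {S : C0Semigroup X}
    {ω₀ ω : ℝ} (hS : S.HasGrowthBound ω₀) (hω : ω₀ < ω) (y : X) (k : ℝ) :
    angularFourier (S.correctedOrbit ω₀ ω y) k =
      unboundedResolvent S.generator ((ω : ℂ) + k * Complex.I) y -
        ((ω : ℂ) + k * Complex.I - ω₀)⁻¹ • y := by
  set z : ℂ := (ω : ℂ) + k * Complex.I with hz
  have hre : ω₀ < z.re := by simpa [hz] using hω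
  have hre' : 0 < (z - ω₀).re := by simpa [hz] using hω
  have hi2 : IntegrableOn (fun s : ℝ => Complex.exp (-((z - ω₀) * s)) • y) (Ioi 0) := by
    have := integrableOn_exp_mul_complex_Ioi (a := -(z - ω₀)) (by
      rw [Complex.neg_re]; linarith) 0
    simp only [neg_mul] at this
    exact Integrable.smul_const this y
  rw [hS.unboundedResolvent_apply hre, laplace, ← integral_cexp_neg_mul_Ioi hre',
    ← integral_smul_const, ← integral_sub (hS.integrableOn hre y) hi2, angularFourier,
    ← integral_indicator measurableSet_Ioi]
  refine integral_congr_ae (Eventually.of_forall fun s => ?_)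
  simp only
  by_cases hs : s ∈ Ioi (0 : ℝ)
  · rw [indicator_of_mem hs, S.correctedOrbit_of_nonneg _ _ _ (le_of_lt hs)]
    simp only [← Complex.coe_smul, smul_sub, smul_smul, Complex.ofReal_exp, ← Complex.exp_add]
    congr 3 <;> (rw [hz]; push_cast; ring)
  · rw [indicator_of_notMem hs, S.correctedOrbit_of_nonpos _ _ _ (not_lt.1 hs), smul_zero]

/-- The factor `i` from `dz = i dk` cancels the one in `1/(2πi)`, and `e^{zt} = e^{ωt} e^{ikt}`. -/
theorem _root_.inversionIntegral_eq_partialInversion {G : ℂ → X} {g : ℝ → X} {ω : ℝ}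
    (h : ∀ k : ℝ, angularFourier g k = G ((ω : ℂ) + k * Complex.I)) (R t : ℝ) :
    inversionIntegral G ω R t = Real.exp (ω * t) • partialInversion g R t := by
  have hI : Complex.I ≠ 0 := Complex.I_ne_zero
  simp only [inversionIntegral, partialInversion, h]
  have e : ∀ k : ℝ, (Complex.exp (((ω : ℂ) + k * Complex.I) * t) * Complex.I) •
      G ((ω : ℂ) + k * Complex.I) = (Complex.I * Complex.exp (ω * t)) •
        (Complex.exp (((k * t : ℝ) : ℂ) * Complex.I) • G ((ω : ℂ) + k * Complex.I)) := by
    intro k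
    rw [smul_smul, mul_assoc, ← Complex.exp_add, mul_comm]
    congr 3
    push_cast
    ring
  simp only [e]
  rw [intervalIntegral.integral_smul, smul_smul, ← Complex.coe_smul, smul_smul]
  congr 1
  push_cast
  field_simp

/-- The error of the truncated inversion integral, with a rate. -/
theorem HasGrowthBound.exists_rate [CompleteSpace X] {S : C0Semigroup X}
    {ω₀ ω β : ℝ} (hS : S.HasGrowthBound ω₀) (hω : ω₀ < ω) (hβ : β ∈ Ioc (0 : ℝ) 1) :
    ∃ K : ℝ, 0 ≤ K ∧ ∀ (y : X) (N : ℝ), ‖y‖ ≤ N →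
      (∀ h ∈ Icc (0 : ℝ) 1, ‖S.op h y - y‖ ≤ N * h ^ β) → ∀ R t : ℝ, 1 ≤ R → 0 ≤ t →
      ‖(S.op t y - (Real.exp (ω₀ * t) : ℂ) • y) - inversionIntegral
        (fun z => unboundedResolvent S.generator z y - (z - (ω₀ : ℂ))⁻¹ • y) ω R t‖ ≤
        K * Real.exp (ω * t) * N * R ^ (-(β / 8)) := by
  obtain ⟨K, hK, H⟩ := hS.exists_holderMean_correctedOrbit hω hβ
  refine ⟨102 / β * K, by have := hβ.1; positivity, fun y N hy hN R t hR ht => ?_⟩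
  have hN0 : 0 ≤ N := (norm_nonneg _).trans hy
  have key := (H y N hy hN).norm_partialInversion_sub_le hβ (by positivity) hR t
  rw [inversionIntegral_eq_partialInversion
    (fun k => hS.angularFourier_correctedOrbit hω y k)]
  have e : S.op t y - (Real.exp (ω₀ * t) : ℂ) • y =
      Real.exp (ω * t) • S.correctedOrbit ω₀ ω y t := by
    rw [S.correctedOrbit_of_nonneg _ _ _ ht, smul_smul, ← Real.exp_add, Complex.coe_smul]
    simp
  rw [e, ← smul_sub, norm_smul, norm_sub_rev, Real.norm_of_nonneg (Real.exp_pos _).le]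
  calc _ ≤ Real.exp (ω * t) * (102 / β * (K * N) * R ^ (-(β / 8))) := by gcongr
    _ = _ := by ring

end C0Semigroup

/-! ### The truncated inversion integral of the scalar resolvent. -/

section ScalarInversion

open MeasureTheory Set

theorem mul_exp_neg_le {c : ℝ} (hc : 0 < c) (s : ℝ) :
    s * Real.exp (-c * s) ≤ 2 / c * Real.exp (-(c / 2) * s) := by
  have h1 : c / 2 * s ≤ Real.exp (c / 2 * s) := by linarith [Real.add_one_le_exp (c / 2 * s)]
  have h2 : Real.exp (-(c / 2) * s) = Real.exp (c / 2 * s) * Real.exp (-c * s) := by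
    rw [← Real.exp_add]; ring_nf
  rw [h2]
  calc s * Real.exp (-c * s) = 2 / c * (c / 2 * s * Real.exp (-c * s)) := by field_simp
    _ ≤ _ := by gcongr

theorem norm_mul_cexp_neg_le {a : ℂ} (ha : 0 < a.re) {s : ℝ} (hs : 0 ≤ s) :
    ‖(s : ℂ) * Complex.exp (-(a * s))‖ ≤ 2 / a.re * Real.exp (-(a.re / 2) * s) := by
  rw [norm_mul, Complex.norm_real, Real.norm_of_nonneg hs, Complex.norm_exp]
  have : (-(a * (s : ℂ))).re = -a.re * s := by simp
  rw [this]
  exact mul_exp_neg_le ha s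

theorem integrableOn_mul_cexp_neg {a : ℂ} (ha : 0 < a.re) :
    IntegrableOn (fun s : ℝ => (s : ℂ) * Complex.exp (-(a * s))) (Ioi 0) := by
  have hi := (integrableOn_exp_mul_Ioi (a := -(a.re / 2)) (by linarith) 0).const_mul (2 / a.re)
  refine Integrable.mono' hi (Continuous.aestronglyMeasurable (by fun_prop)) ?_
  exact (ae_restrict_iff' measurableSet_Ioi).2 (Eventually.of_forall fun s hs =>
    norm_mul_cexp_neg_le ha (le_of_lt hs))

theorem integral_mul_cexp_neg {a : ℂ} (ha : 0 < a.re) :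
    ∫ s in Ioi (0 : ℝ), (s : ℂ) * Complex.exp (-(a * s)) = (a ^ 2)⁻¹ := by
  have ha0 : a ≠ 0 := fun h => by simp [h] at ha
  have hexp : Tendsto (fun s : ℝ => Real.exp (-(a.re / 2) * s)) atTop (𝓝 0) :=
    Real.tendsto_exp_atBot.comp (tendsto_id.const_mul_atTop_of_neg (by linarith))
  have hd : ∀ s ∈ Ici (0 : ℝ), HasDerivAt
      (fun s : ℝ => -(((s : ℂ) * Complex.exp (-(a * s))) / a + Complex.exp (-(a * s)) / a ^ 2))
      ((s : ℂ) * Complex.exp (-(a * s))) s := by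
    intro s _
    have h0 : HasDerivAt (fun s : ℝ => (s : ℂ)) 1 s := (hasDerivAt_id s).ofReal_comp
    have h1 : HasDerivAt (fun s : ℝ => Complex.exp (-(a * s))) (Complex.exp (-(a * s)) * -(a * 1)) s :=
      (h0.const_mul a).neg.cexp
    refine (((h0.mul h1).div_const a).add (h1.div_const (a ^ 2))).neg.congr_deriv ?_
    field_simp
    ring
  have t1 : Tendsto (fun s : ℝ => (s : ℂ) * Complex.exp (-(a * s))) atTop (𝓝 0) := by
    refine squeeze_zero_norm' (a := fun s : ℝ => 2 / a.re * Real.exp (-(a.re / 2) * s)) ?_ ?_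
    · filter_upwards [eventually_ge_atTop 0] with s hs using norm_mul_cexp_neg_le ha hs
    · simpa using hexp.const_mul (2 / a.re)
  have t2 : Tendsto (fun s : ℝ => Complex.exp (-(a * s))) atTop (𝓝 0) := by
    refine squeeze_zero_norm' ?_ hexp
    filter_upwards [eventually_ge_atTop 0] with s hs
    rw [Complex.norm_exp]
    refine Real.exp_le_exp.2 ?_
    have : (-(a * (s : ℂ))).re = -a.re * s := by simp
    rw [this]
    nlinarith
  have ht := ((t1.div_const a).add (t2.div_const (a ^ 2))).neg
  rw [integral_Ioi_of_hasDerivAt_of_tendsto' hd (integrableOn_mul_cexp_neg ha) ht]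
  simp

/-- The truncated inversion integral of the scalar resolvent `(z - ω₀)⁻¹`, with a rate. -/
theorem norm_inversionIntegral_inv_sub_le {ω₀ ω : ℝ} (hω : ω₀ < ω) {R t : ℝ} (hR : 0 < R)
    (ht : 0 < t) :
    ‖(Real.exp (ω₀ * t) : ℂ) - inversionIntegral (fun z => (z - (ω₀ : ℂ))⁻¹) ω R t‖ ≤
      2 * Real.exp (ω * t) / (t * R) := by
  set c : ℝ := ω - ω₀ with hc
  have hc0 : 0 < c := sub_pos.2 hω
  set a : ℝ → ℂ := fun k => (c : ℂ) + k * Complex.I with ha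
  have hare : ∀ k, (a k).re = c := fun k => by simp [ha]
  have haim : ∀ k, (a k).im = k := fun k => by simp [ha]
  have hne : ∀ k, a k ≠ 0 := fun k h => by
    have := hare k
    rw [h] at this
    exact hc0.ne this
  have hac : Continuous a := by fun_prop
  have hak : ∀ k, |k| ≤ ‖a k‖ := fun k => by
    have := Complex.abs_im_le_norm (a k)
    rwa [haim] at this
  -- The transform `1/a` of `e^{-cs}` on `s > 0` is not absolutely integrable. The extra factor `s`
  -- gives the transform `1/a²` and continuity at `0`, and `e^{-ct}` is recovered as `g(t)/t`.
  set g : ℝ → ℂ := fun s => ((max s 0 * Real.exp (-c * max s 0) : ℝ) : ℂ) with hg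
  have hgc : Continuous g := by fun_prop
  have hg0 : ∀ s ≤ 0, g s = 0 := fun s hs => by simp [hg, max_eq_right hs]
  have hgp : ∀ k s : ℝ, 0 ≤ s → Complex.exp (-((k * s : ℝ) : ℂ) * Complex.I) • g s =
      (s : ℂ) * Complex.exp (-(a k * s)) := by
    intro k s hs
    simp only [hg, max_eq_left hs, smul_eq_mul, Complex.ofReal_mul, Complex.ofReal_exp]
    rw [mul_left_comm, ← Complex.exp_add]
    congr 2
    simp only [ha]
    push_cast
    ring
  have hind : ∀ k s : ℝ, Complex.exp (-((k * s : ℝ) : ℂ) * Complex.I) • g s =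
      (Ioi (0 : ℝ)).indicator (fun s : ℝ => (s : ℂ) * Complex.exp (-(a k * s))) s := by
    intro k s
    by_cases hs : s ∈ Ioi (0 : ℝ)
    · rw [indicator_of_mem hs, hgp k s (le_of_lt hs)]
    · rw [indicator_of_notMem hs, hg0 s (not_lt.1 hs), smul_zero]
  have hgi : Integrable g := by
    have h1 := (integrableOn_mul_cexp_neg (a := a 0) (by rw [hare]; exact hc0)).integrable_indicator
      measurableSet_Ioi
    refine h1.congr (Eventually.of_forall fun s => ?_)
    simp only [← hind]
    simp
  have hgf : ∀ k, angularFourier g k = (a k ^ 2)⁻¹ := by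
    intro k
    simp only [angularFourier, hind]
    rw [integral_indicator measurableSet_Ioi, integral_mul_cexp_neg (by rw [hare]; exact hc0)]
  have hbound : ∀ k : ℝ, k ≠ 0 → ‖angularFourier g k‖ ≤ 1 / k ^ 2 := by
    intro k hk
    rw [hgf, norm_inv, norm_pow, ← one_div, ← sq_abs k]
    have := abs_pos.2 hk
    gcongr
    exact hak k
  have hinv := norm_partialInversion_sub_le hgc hgi hbound hR t
  have htne : (t : ℂ) * Complex.I ≠ 0 :=
    mul_ne_zero (Complex.ofReal_ne_zero.2 ht.ne') Complex.I_ne_zero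
  set e : ℝ → ℂ := fun k => Complex.exp (((k * t : ℝ) : ℂ) * Complex.I) with he
  have hec : Continuous e := by fun_prop
  have hen : ∀ k, ‖e k‖ = 1 := fun k => Complex.norm_exp_ofReal_mul_I _
  have hd1 : ∀ k : ℝ, HasDerivAt a Complex.I k := fun k => by
    have h0 : HasDerivAt (fun s : ℝ => (s : ℂ)) 1 k := (hasDerivAt_id k).ofReal_comp
    exact ((h0.mul_const Complex.I).const_add (c : ℂ)).congr_deriv (one_mul _)
  have hd2 : ∀ k : ℝ, HasDerivAt (fun k => (a k)⁻¹) (-Complex.I / a k ^ 2) k := fun k =>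
    (hd1 k).inv (hne k)
  have hd3 : ∀ k : ℝ, HasDerivAt (fun k => e k / (t * Complex.I)) (e k) k := fun k => by
    have h0 : HasDerivAt (fun s : ℝ => ((s * t : ℝ) : ℂ)) t k := by
      simpa using ((hasDerivAt_id k).mul_const t).ofReal_comp
    have h1 := ((h0.mul_const Complex.I).cexp).div_const (t * Complex.I)
    refine h1.congr_deriv ?_
    rw [mul_div_assoc, div_self htne, mul_one]
  -- Integrating `e^{ikt}` trades `1/a` for `1/a²` and a factor `1/t`; the boundary terms are `O(1 /
  -- (tR))`.
  have hparts := intervalIntegral.integral_mul_deriv_eq_deriv_mul (a := -R) (b := R)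
    (fun k _ => hd2 k) (fun k _ => hd3 k)
    (Continuous.intervalIntegrable (by
      refine Continuous.div (by fun_prop) (by fun_prop) fun k => pow_ne_zero 2 (hne k)) _ _)
    (hec.intervalIntegrable _ _)
  set B : ℂ := (a R)⁻¹ * (e R / (t * Complex.I)) - (a (-R))⁻¹ * (e (-R) / (t * Complex.I)) with hB
  have hBn : ‖B‖ ≤ 2 / (t * R) := by
    have h1 : ∀ k : ℝ, |k| = R → ‖(a k)⁻¹ * (e k / (t * Complex.I))‖ ≤ 1 / (t * R) := by
      intro k hk
      rw [norm_mul, norm_inv, norm_div, hen, norm_mul, Complex.norm_I, mul_one, Complex.norm_real,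
        Real.norm_of_nonneg ht.le, ← one_div, div_mul_div_comm, one_mul, mul_comm t R]
      have := hak k
      rw [hk] at this
      gcongr
    refine (norm_sub_le_of_le (h1 R (abs_of_pos hR)) (h1 (-R) (by rw [abs_neg, abs_of_pos hR]))).trans_eq ?_
    ring
  have hlast : ∫ k in (-R)..R, -Complex.I / a k ^ 2 * (e k / (t * Complex.I)) =
      -(t : ℂ)⁻¹ * ∫ k in (-R)..R, e k • angularFourier g k := by
    rw [← intervalIntegral.integral_const_mul]
    refine intervalIntegral.integral_congr fun k _ => ?_
    have h1 := hne k
    have h2 : (t : ℂ) ≠ 0 := Complex.ofReal_ne_zero.2 ht.ne'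
    simp only [hgf, smul_eq_mul]
    field_simp
  rw [hlast] at hparts
  have hinvI : inversionIntegral (fun z => (z - (ω₀ : ℂ))⁻¹) ω R t =
      Real.exp (ω * t) * ((2 * Real.pi : ℂ)⁻¹ * ∫ k in (-R)..R, (a k)⁻¹ * e k) := by
    rw [inversionIntegral, smul_eq_mul]
    have e1 : ∀ k : ℝ, (Complex.exp (((ω : ℂ) + k * Complex.I) * t) * Complex.I) •
        ((ω : ℂ) + k * Complex.I - ω₀)⁻¹ = (Complex.I * Complex.exp (ω * t)) *
          ((a k)⁻¹ * e k) := by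
      intro k
      have h1 : Complex.exp (((ω : ℂ) + k * Complex.I) * t) = Complex.exp (ω * t) * e k := by
        rw [he, ← Complex.exp_add]
        congr 1
        push_cast
        ring
      have h2 : (ω : ℂ) + k * Complex.I - ω₀ = a k := by
        simp only [ha, hc]
        push_cast
        ring
      rw [h1, h2, smul_eq_mul]
      ring
    simp only [e1, intervalIntegral.integral_const_mul]
    push_cast
    have := Complex.I_ne_zero
    field_simp
  have hgt : (Real.exp (ω₀ * t) : ℂ) = Real.exp (ω * t) * ((t : ℂ)⁻¹ * g t) := by
    have h2 : (t : ℂ) ≠ 0 := Complex.ofReal_ne_zero.2 ht.ne'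
    have : Real.exp (ω₀ * t) = Real.exp (ω * t) * Real.exp (-c * t) := by
      rw [← Real.exp_add, hc]; ring_nf
    simp only [hg, max_eq_left ht.le]
    rw [this]
    push_cast
    field_simp
  have hsplit : (Real.exp (ω₀ * t) : ℂ) - inversionIntegral (fun z => (z - (ω₀ : ℂ))⁻¹) ω R t =
      Real.exp (ω * t) * (-(t : ℂ)⁻¹ * (partialInversion g R t - g t) -
        (2 * Real.pi : ℂ)⁻¹ * B) := by
    rw [hinvI, hgt, hparts, partialInversion, smul_eq_mul]
    ring
  have hn : ‖(2 * Real.pi : ℂ)⁻¹‖ ≤ 2⁻¹ := by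
    rw [norm_inv, norm_mul, Complex.norm_real, Complex.norm_ofNat, Real.norm_of_nonneg Real.pi_nonneg]
    apply inv_anti₀ (by norm_num)
    nlinarith [Real.pi_gt_three]
  rw [hsplit, norm_mul, Complex.norm_real, Real.norm_of_nonneg (Real.exp_pos _).le]
  have b1 : ‖-(t : ℂ)⁻¹ * (partialInversion g R t - g t)‖ ≤ t⁻¹ * (1 / R) := by
    rw [norm_mul, norm_neg, norm_inv, Complex.norm_real, Real.norm_of_nonneg ht.le]
    gcongr
  have b2 : ‖(2 * Real.pi : ℂ)⁻¹ * B‖ ≤ 2⁻¹ * (2 / (t * R)) := by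
    rw [norm_mul]
    gcongr
  calc _ ≤ Real.exp (ω * t) * (t⁻¹ * (1 / R) + 2⁻¹ * (2 / (t * R))) := by
        gcongr
        exact norm_sub_le_of_le b1 b2
    _ = _ := by field_simp; ring

end ScalarInversion

/-! ### From rates on Hölder classes to convergence in Favard norms. -/

namespace C0Semigroup

open MeasureTheory Set

variable {X : Type*} [NormedAddCommGroup X] [NormedSpace ℂ X]

theorem norm_op_sub_le_of_mem_favardSpace {S : C0Semigroup X} {α : ℝ} {x : X}
    (hx : x ∈ S.favardSpace α) : ∃ M : ℝ, 0 ≤ M ∧ ∀ h, 0 < h → ‖S.op h x - x‖ ≤ M * h ^ α := by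
  refine ⟨(S.favardNorm α x).toReal, ENNReal.toReal_nonneg, fun h hh => ?_⟩
  have h1 : ENNReal.ofReal (‖S.op h x - x‖ / h ^ α) ≤ S.favardNorm α x :=
    le_iSup (fun t : Ioi (0 : ℝ) => ENNReal.ofReal (‖S.op (t : ℝ) x - x‖ / (t : ℝ) ^ α)) ⟨h, hh⟩
  have h2 := (ENNReal.ofReal_le_iff_le_toReal (ne_of_lt hx)).1 h1
  rwa [div_le_iff₀ (Real.rpow_pos_of_pos hh _)] at h2

theorem favardNorm_le {S : C0Semigroup X} {α N : ℝ} {x : X}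
    (hx : ∀ h, 0 < h → ‖S.op h x - x‖ ≤ N * h ^ α) : S.favardNorm α x ≤ ENNReal.ofReal N := by
  refine iSup_le fun h => ENNReal.ofReal_le_ofReal ?_
  rw [div_le_iff₀ (Real.rpow_pos_of_pos h.2 _)]
  exact hx h h.2

/-- The increments `S(h)x - x` of an element of `F_α`, measured in a weaker Favard norm. -/
theorem exists_increment_bound {S : C0Semigroup X} {C : ℝ} (hC : 0 ≤ C)
    (hS : ∀ t, 0 ≤ t → ∀ y, ‖S.op t y‖ ≤ C * ‖y‖) {α α' : ℝ} (hα' : α' ∈ Ioo 0 α) {x : X}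
    (hx : x ∈ S.favardSpace α) : ∃ N : ℝ, 0 ≤ N ∧ ∀ h, 0 < h →
      ‖S.op h x - x‖ ≤ N * h ^ α' ∧ ∀ r ∈ Icc (0 : ℝ) 1,
        ‖S.op r (S.op h x - x) - (S.op h x - x)‖ ≤ N * h ^ α' * r ^ (α - α') := by
  obtain ⟨M, hM0, hM⟩ := norm_op_sub_le_of_mem_favardSpace hx
  have hS1 : ∀ t, 0 ≤ t → ∀ y, ‖S.op t y - y‖ ≤ (C + 1) * ‖y‖ := fun t ht y =>
    (norm_sub_le_of_le (hS t ht y) le_rfl).trans_eq (by ring)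
  refine ⟨(C + 1) * M + (C + 1) * ‖x‖, by positivity, fun h hh => ⟨?_, fun r hr => ?_⟩⟩
  · have hhα : 0 < h ^ α' := Real.rpow_pos_of_pos hh _
    rcases le_total h 1 with h1 | h1
    · calc _ ≤ M * h ^ α := hM h hh
        _ ≤ M * h ^ α' := by
            gcongr ?_ * ?_
            exact Real.rpow_le_rpow_of_exponent_ge hh h1 hα'.2.le
        _ ≤ _ := by
            gcongr
            have : 0 ≤ C * M := by positivity
            have : 0 ≤ (C + 1) * ‖x‖ := by positivity
            linarith
    -- For `h ≥ 1` the boundedness of the semigroup replaces the Favard estimate.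
    · have h1' : 1 ≤ h ^ α' := Real.one_le_rpow h1 hα'.1.le
      calc _ ≤ (C + 1) * ‖x‖ := hS1 h hh.le x
        _ ≤ (C + 1) * M + (C + 1) * ‖x‖ := by
            have : 0 ≤ (C + 1) * M := by positivity
            linarith
        _ ≤ _ := le_mul_of_one_le_right (by positivity) h1'
  · rcases hr.1.eq_or_lt with h0 | h0
    · rw [← h0, S.op_zero]
      simp only [ContinuousLinearMap.id_apply, sub_self, norm_zero]
      positivity
    · have hrα : 0 < r ^ (α - α') := Real.rpow_pos_of_pos h0 _
      have hhα : 0 < h ^ α' := Real.rpow_pos_of_pos hh _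
      -- The expression `(S(r) - 1)(S(h) - 1)x` is symmetric in `r` and `h`, hence bounded by `(C +
      -- 1) M min(h, r)^α`, and `min(h, r)^α ≤ h^{α'} r^{α-α'}`.
      have key : ‖S.op r (S.op h x - x) - (S.op h x - x)‖ ≤
          (C + 1) * M * (h ^ α' * r ^ (α - α')) := by
        rcases le_total h r with hle | hle
        · calc _ ≤ (C + 1) * ‖S.op h x - x‖ := hS1 r h0.le _
            _ ≤ (C + 1) * (M * h ^ α) := by gcongr; exact hM h hh
            _ = (C + 1) * M * (h ^ α' * h ^ (α - α')) := by
                rw [← Real.rpow_add hh, add_sub_cancel]; ring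
            _ ≤ _ := by
                gcongr
                linarith [hα'.2]
        · have e : S.op r (S.op h x - x) - (S.op h x - x) =
              S.op h (S.op r x - x) - (S.op r x - x) := by
            rw [map_sub, map_sub, S.op_comm h0.le hh.le]
            abel
          rw [e]
          calc _ ≤ (C + 1) * ‖S.op r x - x‖ := hS1 h hh.le _
            _ ≤ (C + 1) * (M * r ^ α) := by gcongr; exact hM r h0
            _ = (C + 1) * M * (r ^ α' * r ^ (α - α')) := by
                rw [← Real.rpow_add h0, add_sub_cancel]; ring
            _ ≤ _ := by
                gcongr
                exact hα'.1.le
      refine key.trans ?_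
      rw [mul_assoc _ (h ^ α')]
      refine mul_le_mul_of_nonneg_right ?_ (by positivity)
      have : 0 ≤ (C + 1) * ‖x‖ := by positivity
      linarith

/-- A continuous weight is bounded near `t`, so a rate with weight `b` is locally uniform.
Membership `τ ∈ s` is kept because the rate holds only there. -/
theorem _root_.exists_nhdsWithin_mul_lt {s : Set ℝ} {b ρ : ℝ → ℝ} (hb : ContinuousOn b s)
    (hρ : Tendsto ρ atTop (𝓝 0)) {ε : ℝ} (hε : 0 < ε) {t : ℝ} (ht : t ∈ s) :
    ∃ V ∈ 𝓝[s] t, ∀ᶠ R in atTop, ∀ τ ∈ V, τ ∈ s ∧ b τ * ρ R < ε := by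
  have hV : ∀ᶠ τ in 𝓝[s] t, |b τ| < |b t| + 1 :=
    ((hb t ht).abs).eventually (gt_mem_nhds (by linarith))
  have hR : Tendsto (fun R => (|b t| + 1) * |ρ R|) atTop (𝓝 0) := by
    simpa using (hρ.abs).const_mul (|b t| + 1)
  refine ⟨_, inter_mem hV self_mem_nhdsWithin, ?_⟩
  filter_upwards [hR.eventually (gt_mem_nhds hε)] with R hR τ hτ
  refine ⟨hτ.2, lt_of_le_of_lt ?_ hR⟩
  calc b τ * ρ R ≤ |b τ| * |ρ R| := by rw [← abs_mul]; exact le_abs_self _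
    _ ≤ _ := mul_le_mul_of_nonneg_right (le_of_lt hτ.1) (abs_nonneg _)

/-- A linear approximation scheme which commutes with the semigroup and has a rate on the Hölder
classes converges locally uniformly in `X` and in weaker Favard norms. -/
theorem tendstoLocallyUniformlyOn_of_rate {S : C0Semigroup X} {C : ℝ} (hC : 0 ≤ C)
    (hS : ∀ t, 0 ≤ t → ∀ y, ‖S.op t y‖ ≤ C * ‖y‖) {s : Set ℝ} {Φ : ℝ → ℝ → X →L[ℂ] X}
    {Ψ : ℝ → X →L[ℂ] X}
    (hΦ : ∀ R t h y, 0 ≤ h → S.op h (Φ R t y) = Φ R t (S.op h y))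
    (hΨ : ∀ t ∈ s, ∀ h y, 0 ≤ h → S.op h (Ψ t y) = Ψ t (S.op h y))
    (hrate : ∀ β ∈ Ioc (0 : ℝ) 1, ∃ b : ℝ → ℝ, ContinuousOn b s ∧ ∀ (y : X) (N : ℝ), ‖y‖ ≤ N →
      (∀ h ∈ Icc (0 : ℝ) 1, ‖S.op h y - y‖ ≤ N * h ^ β) → ∀ R t : ℝ, 1 ≤ R → t ∈ s →
      ‖Ψ t y - Φ R t y‖ ≤ b t * N * R ^ (-(β / 8)))
    {α : ℝ} (hα : α ∈ Ioc (0 : ℝ) 1) {x : X} (hx : x ∈ S.favardSpace α) :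
    TendstoLocallyUniformlyOn (fun R t => Φ R t x) (fun t => Ψ t x) atTop s ∧
      ∀ α' ∈ Ioo (0 : ℝ) α, S.FavardTendstoLocallyUniformlyOn α' (fun R t => Φ R t x)
        (fun t => Ψ t x) s := by
  have hρ : ∀ β : ℝ, 0 < β → Tendsto (fun R : ℝ => R ^ (-(β / 8))) atTop (𝓝 0) := fun β hβ =>
    tendsto_rpow_neg_atTop (by linarith)
  constructor
  · rw [Metric.tendstoLocallyUniformlyOn_iff]
    intro ε hε t ht
    obtain ⟨b, hb, H⟩ := hrate α hα
    obtain ⟨M, hM0, hM⟩ := norm_op_sub_le_of_mem_favardSpace hx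
    have hH := H x (‖x‖ + M) (by linarith) fun h hh => by
      rcases hh.1.eq_or_lt with h0 | h0
      · rw [← h0, S.op_zero]
        simp only [ContinuousLinearMap.id_apply, sub_self, norm_zero]
        positivity
      · refine (hM h h0).trans ?_
        gcongr
        linarith [norm_nonneg x]
    obtain ⟨V, hV, hV'⟩ := exists_nhdsWithin_mul_lt (b := fun τ => b τ * (‖x‖ + M)) (by fun_prop)
      (hρ α hα.1) hε ht
    refine ⟨V, hV, ?_⟩
    filter_upwards [hV', eventually_ge_atTop 1] with R hR hR1 τ hτ
    rw [dist_eq_norm]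
    exact (hH R τ hR1 (hR τ hτ).1).trans_lt (hR τ hτ).2
  · intro α' hα'
    obtain ⟨N, hN0, hN⟩ := exists_increment_bound hC hS hα' hx
    have hmem : ∀ T : X →L[ℂ] X, (∀ h y, 0 ≤ h → S.op h (T y) = T (S.op h y)) →
        T x ∈ S.favardSpace α' := by
      intro T hT
      refine (favardNorm_le (N := ‖T‖ * N) fun h hh => ?_).trans_lt ENNReal.ofReal_lt_top
      rw [hT h x hh.le, ← map_sub, mul_assoc]
      exact (T.le_opNorm _).trans (by gcongr; exact (hN h hh).1)
    refine ⟨fun t ht => hmem _ (hΨ t ht), fun R _ t _ => hmem _ (hΦ R t), fun ε hε t ht => ?_⟩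
    obtain ⟨ε', hε'0, hε'⟩ := ENNReal.lt_iff_exists_nnreal_btwn.1 hε
    have hε'' : (0 : ℝ) < ε' := by exact_mod_cast hε'0
    -- The rate is applied at order `α - α'` to `S(h)x - x` with constant `N h^{α'}`, uniformly in
    -- `h > 0`.
    obtain ⟨b, hb, H⟩ := hrate (α - α') ⟨sub_pos.2 hα'.2, by linarith [hα.2, hα'.1]⟩
    obtain ⟨V, hV, hV'⟩ := exists_nhdsWithin_mul_lt (b := fun τ => b τ * N) (by fun_prop)
      (hρ (α - α') (sub_pos.2 hα'.2)) hε'' ht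
    refine ⟨V, hV, ?_⟩
    filter_upwards [hV', eventually_ge_atTop 1] with R hR hR1 τ hτ
    refine lt_of_le_of_lt (favardNorm_le (N := b τ * N * R ^ (-((α - α') / 8))) fun h hh => ?_) ?_
    · have e : S.op h (Ψ τ x - Φ R τ x) - (Ψ τ x - Φ R τ x) =
          Ψ τ (S.op h x - x) - Φ R τ (S.op h x - x) := by
        rw [map_sub, hΨ τ (hR τ hτ).1 h x hh.le, hΦ R τ h x hh.le, map_sub, map_sub]
        abel
      rw [e]
      refine (H _ _ (hN h hh).1 (hN h hh).2 R τ hR1 (hR τ hτ).1).trans_eq ?_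
      ring
    · refine lt_trans ?_ hε'
      rw [← ENNReal.ofReal_coe_nnreal, ENNReal.ofReal_lt_ofReal_iff hε'']
      exact (hR τ hτ).2

end C0Semigroup

/-! ### The two inversion formulas. -/

theorem mainTheorem3 {X : Type*} [NormedAddCommGroup X] [NormedSpace ℂ X] [CompleteSpace X]
    (S : C0Semigroup X) (ω₀ : ℝ) (hω₀ : ω₀ < 0) (hS : S.HasGrowthBound ω₀)
    (α : ℝ) (hα : α ∈ Set.Ioc (0 : ℝ) 1) (x : X) (hx : x ∈ S.favardSpace α)
    (ω : ℝ) (hω : ω₀ < ω) :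
    -- the integrands below are well defined and continuous
    {z : ℂ | ω₀ < z.re} ⊆ unboundedResolventSet S.generator ∧
    ContinuousOn (fun z : ℂ => unboundedResolvent S.generator z x) {z : ℂ | ω₀ < z.re} ∧
    -- first inversion formula, in the norm of `X` and in the norm of `F_α'`
    (TendstoLocallyUniformlyOn
        (fun R t : ℝ => inversionIntegral
          (fun z => unboundedResolvent S.generator z x - (z - (ω₀ : ℂ))⁻¹ • x) ω R t)
        (fun t : ℝ => S.op t x - (Real.exp (ω₀ * t) : ℂ) • x) atTop (Set.Ici 0) ∧
      ∀ α' ∈ Set.Ioo (0 : ℝ) α, S.FavardTendstoLocallyUniformlyOn α'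
        (fun R t : ℝ => inversionIntegral
          (fun z => unboundedResolvent S.generator z x - (z - (ω₀ : ℂ))⁻¹ • x) ω R t)
        (fun t : ℝ => S.op t x - (Real.exp (ω₀ * t) : ℂ) • x) (Set.Ici 0)) ∧
    -- second inversion formula, in the norm of `X` and in the norm of `F_α'`
    (TendstoLocallyUniformlyOn
        (fun R t : ℝ => inversionIntegral
          (fun z => unboundedResolvent S.generator z x) ω R t)
        (fun t : ℝ => S.op t x) atTop (Set.Ioi 0) ∧
      ∀ α' ∈ Set.Ioo (0 : ℝ) α, S.FavardTendstoLocallyUniformlyOn α'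
        (fun R t : ℝ => inversionIntegral
          (fun z => unboundedResolvent S.generator z x) ω R t)
        (fun t : ℝ => S.op t x) (Set.Ioi 0)) := by
  -- Since `ω₀ < 0`, the exponent `w = 0` is admissible and the semigroup is bounded.
  obtain ⟨C, hC1, hC'⟩ := hS.exists_bound hω₀
  have hC : ∀ t, 0 ≤ t → ∀ y, ‖S.op t y‖ ≤ C * ‖y‖ := fun t ht y => by simpa using hC' t ht y
  have hC0 : 0 ≤ C := by linarith
  choose V hV hVc using hS.exists_clm_inversionIntegral hω
  set σ : ℝ → ℝ → ℂ := fun R t => inversionIntegral (fun z => (z - (ω₀ : ℂ))⁻¹) ω R t with hσ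
  have hU : ∀ R t y, inversionIntegral
      (fun z => unboundedResolvent S.generator z y - (z - (ω₀ : ℂ))⁻¹ • y) ω R t =
      (V R t - σ R t • ContinuousLinearMap.id ℂ X) y := by
    intro R t y
    simp only [sub_apply, smul_apply,
      ContinuousLinearMap.id_apply, hV, hσ, inversionIntegral, smul_sub]
    have hres := hS.continuous_unboundedResolvent_line hω y
    have hsc : Continuous fun k : ℝ => ((ω : ℂ) + k * Complex.I - ω₀)⁻¹ := by
      refine Continuous.inv₀ (by fun_prop) fun k h => ?_
      have := congrArg Complex.re h
      simp at this
      linarith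
    rw [intervalIntegral.integral_sub (Continuous.intervalIntegrable (by fun_prop) _ _)
      (Continuous.intervalIntegrable (by fun_prop) _ _), smul_sub, smul_assoc,
      ← intervalIntegral.integral_smul_const]
    simp only [smul_assoc]
  refine ⟨fun z hz => hS.mem_unboundedResolventSet hz, hS.continuousOn_unboundedResolvent x, ?_, ?_⟩
  · have key := C0Semigroup.tendstoLocallyUniformlyOn_of_rate hC0 hC (s := Set.Ici 0)
      (Φ := fun R t => V R t - σ R t • ContinuousLinearMap.id ℂ X)
      (Ψ := fun t => S.op t - (Real.exp (ω₀ * t) : ℂ) • ContinuousLinearMap.id ℂ X)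
      (fun R t h y hh => by simp [hVc R t h hh]) (fun t ht h y hh => by simp [S.op_comm hh ht])
      (fun β hβ => by
        obtain ⟨K, -, H⟩ := hS.exists_rate hω hβ
        refine ⟨fun t => K * Real.exp (ω * t), by fun_prop, fun y N hy hN R t hR ht => ?_⟩
        have := H y N hy hN R t hR ht
        rw [hU] at this
        exact this) hα hx
    simp only [hU]
    exact key
  · have key := C0Semigroup.tendstoLocallyUniformlyOn_of_rate hC0 hC (s := Set.Ioi 0)
      (Φ := V) (Ψ := S.op) (fun R t h y hh => hVc R t h hh y)
      (fun t ht h y hh => S.op_comm hh (le_of_lt ht) y)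
      (fun β hβ => by
        obtain ⟨K, -, H⟩ := hS.exists_rate hω hβ
        -- The second weight, from the scalar inversion, blows up at `t = 0`; this is why the
        -- formula is restricted to `t > 0`.
        refine ⟨fun t => K * Real.exp (ω * t) + 2 * Real.exp (ω * t) / t, ?_,
          fun y N hy hN R t hR ht => ?_⟩
        · exact ContinuousOn.add (by fun_prop) (ContinuousOn.div (by fun_prop) (by fun_prop)
            fun t ht => ne_of_gt ht)
        · have ht0 : 0 < t := ht
          have hR0 : 0 < R := by linarith
          have h1 := H y N hy hN R t hR ht0.le
          rw [hU] at h1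
          have h2 := norm_inversionIntegral_inv_sub_le hω hR0 ht0
          have hRβ : R⁻¹ ≤ R ^ (-(β / 8)) := by
            rw [← Real.rpow_neg_one]
            exact Real.rpow_le_rpow_of_exponent_le hR (by linarith [hβ.2])
          have e : S.op t y - V R t y = (S.op t y - (Real.exp (ω₀ * t) : ℂ) • y -
              (V R t - σ R t • ContinuousLinearMap.id ℂ X) y) +
              ((Real.exp (ω₀ * t) : ℂ) - σ R t) • y := by
            simp only [sub_apply, smul_apply,
              ContinuousLinearMap.id_apply, sub_smul]
            abel
          have h3 : ‖((Real.exp (ω₀ * t) : ℂ) - σ R t) • y‖ ≤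
              2 * Real.exp (ω * t) / t * N * R ^ (-(β / 8)) := by
            rw [norm_smul]
            calc _ ≤ 2 * Real.exp (ω * t) / (t * R) * N := by gcongr
              _ = 2 * Real.exp (ω * t) / t * N * R⁻¹ := by field_simp
              _ ≤ _ := by
                have : 0 ≤ N := (norm_nonneg _).trans hy
                gcongr
          rw [e]
          refine (norm_add_le_of_le h1 h3).trans_eq ?_
          ring) hα hx
    simp only [hV] at key
    exact key
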